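/- Let $d,e,r\ge 1$ be integers, let $\mathcal U_m$ be the group of complex $m$-th roots of unity, $\zeta$ a generator of $\mathcal U_{de}$, $\mathfrak S_r$ the symmetric group, and $G=G(de,1,r)=\mathcal U_{de}^r\rtimes\mathfrak S_r$, with elements $(z;\sigma)$. Indices of multipartitions are taken modulo $de$. *Representations.* Let $\underline\lambda=(\lambda^{(0)},\dots,\lambda^{(de-1)})$ be a $de$-multipartition of $r$, and $c_i=|\lambda^{(i)}|$. Let $\mathcal X_c$ be the set of $X=(X_0,\dots,X_{de-1})$ with $\{1,\dots,r\}=\bigsqcup_i X_i$ and $|X_i|=c_i$; write $X_i=\{x_{i,1}<\cdots<x_{i,c_i}\}$ and $\sigma X=(\sigma(X_0),\dots,\sigma(X_{de-1}))$. Let $V_{\lambda^{(i)}}$ be the Specht module of $\mathfrak S_{c_i}$ labelled by $\lambda^{(i)}$. The irreducible representation $\rho_{\underline\lambda}$ of $G$ labelled by $\underline\lambda$ acts on the induced module $W_{\underline\lambda}=\bigoplus_{X\in\mathcal X_c}t_X\otimes\bigl(\bigotimes_i V_{\lambda^{(i)}}\bigr)$ by $$\rho_{\underline\lambda}(z;\sigma)\Bigl(t_X\otimes\bigotimes_i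 v_i\Bigr)=\Bigl(\prod_i\prod_{x\in\sigma(X_i)}z_x^{\,i}\Bigr)\,t_{\sigma X}\otimes\bigotimes_i\widetilde\sigma_i v_i ,$$ where $\widetilde\sigma_i\in\mathfrak S_{c_i}$ is given by $\sigma(x_{i,j})=y_{i,\widetilde\sigma_i(j)}$ with $\sigma(X_i)=\{y_{i,1}<\cdots<y_{i,c_i}\}$. Let $\varepsilon(z;\sigma)=(z_1\cdots z_r)^d$, a linear character of $G$ of order $e$ with kernel $G(de,e,r)$, and let $C_{\underline\lambda}=\{\varepsilon^j\mid\varepsilon^j\otimes\rho_{\underline\lambda}\cong\rho_{\underline\lambda}\}$. Let $b_{\underline\lambda}$ be the divisor of $e$ with $C_{\underline\lambda}=\langle\varepsilon^{b_{\underline\lambda}}\rangle$; then $\lambda^{(i+db_{\underline\lambda})}=\lambda^{(i)}$ for all $i$. Let $M_{\underline\lambda}$ be the isomorphism from $\rho_{\underline\lambda}$ to $\varepsilon^{b_{\underline\lambda}}\otimes\rho_{\underline\lambda}$ given by $$M_{\underline\lambda}\Bigl(t_X\otimes\bigotimes_i v_i\Bigr)=t_{m(X)}\otimes\bigotimes_i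 v_{i+db_{\underline\lambda}},\qquad m(X)_i=X_{i+db_{\underline\lambda}} .$$ Let $b'$ be a divisor of $|C_{\underline\lambda}|$, $q=|C_{\underline\lambda}|/b'$, and let $r'$ be such that $r=qr'$ (it exists). For $g\in G$ put $\Delta_{\underline\lambda,b'}(g)=\operatorname{Tr}\bigl(M_{\underline\lambda}^{b'}\circ\rho_{\underline\lambda}(g)\bigr)$. Let $\underline\mu=(\lambda^{(0)},\dots,\lambda^{(db_{\underline\lambda}b'-1)})$, so that $\underline\lambda=(\underline\mu,\dots,\underline\mu)$ ($q$ times), and let $\chi_{\underline\mu}$ be the character of the irreducible representation of $G(de,1,r')$ labelled by $(\underline\mu,\emptyset,\dots,\emptyset)$. *Classes.* The cycle product of $(z;\sigma)$ along a cycle of $\sigma$ (fixed points included) is the product of the $z_x$ over the support of the cycle. An element has cyclic structure $\underline\eta=(\eta_0,\dots,\eta_{de-1})$ if the parts of $\eta_u$ are the lengths of its cycles with cycle product $\zeta^u$, for every $u$. For a $de$-multipartition $\underline\eta$ of $r$, list its parts in some order, the $j$-th one having length $\ell_j$ and belonging to $\eta_{u_j}$ ($1\le j\le s$), and let $L_j=\ell_1+\cdots+\ell_{j-1}$.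 Let $g_{\underline\eta}=(z;\sigma)$ where $\sigma$ is the product of the cycles $\sigma_j=(L_j+1\ \cdots\ L_j+\ell_j)$, $z_{L_j+1}=\zeta^{u_j}$ for all $j$, and all other $z_x$ are $1$. Let $\xi_j$ be the cycle product of $g_{\underline\eta}$ along $\sigma_j$. For a partition $\pi=(\pi_1,\dots,\pi_t)$ write $q\star\pi=(q\pi_1,\dots,q\pi_t)$ and $\ell(\pi)=t$, and put $\ell(\underline\eta)=\sum_u\ell(\eta_u)$. **Theorem.** (i) If some $\eta_u$ ($0\le u\le de-1$) is not of the form $q\star\pi$ with $\pi$ a partition, or if $\xi_j\notin\mathcal U_{db_{\underline\lambda}b'}$ for some $j$, then $\Delta_{\underline\lambda,b'}(g_{\underline\eta})=0$. (ii) If $\eta_u=q\star\eta'_u$ for all $0\le u\le de-1$ and $\xi_j\in\mathcal U_{db_{\underline\lambda}b'}$ for all $1\le j\le s$, then $$\Delta_{\underline\lambda,b'}(g_{\underline\eta})=q^{\ell(\underline\eta)}\,\chi_{\underline\mu}(g'_{\underline\eta})$$ for every $g'_{\underline\eta}\in G(de,1,r')$ with cyclic structure $(\eta'_0,\dots,\eta'_{de-1})$.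 -/

import Mathlib

set_option linter.unusedSectionVars false

open scoped TensorProduct
open Equiv (Perm)

noncomputable section

namespace WreathChar

/-! ### Specht modules of symmetric groups -/

/-- Bijective fillings of the boxes of `lam` by the `|lam|` letters. -/
abbrev Tableau (lam : YoungDiagram) : Type := lam.cells ≃ Fin lam.card

/-- The tabloid of a tableau: it remembers only the row in which each letter lies. -/
def tabloid {lam : YoungDiagram} (t : Tableau lam) : Fin lam.card → ℕ :=
  fun x => (t.symm x).1.1

/-- The permutations of the boxes of `lam` that preserve every column. -/
def columnStabilizer (lam : YoungDiagram) : Finset (Perm lam.cells) :=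
  Finset.univ.filter fun p => ∀ c, (p c).1.2 = c.1.2

/-- The polytabloid `e_t`: the signed sum of `{π t}` over the column stabilizer of `t`. -/
def polytabloid {lam : YoungDiagram} (t : Tableau lam) : (Fin lam.card → ℕ) →₀ ℂ :=
  ∑ p ∈ columnStabilizer lam,
    (((Perm.sign p : ℤˣ) : ℤ) : ℂ) • Finsupp.single (tabloid (p.trans t)) (1 : ℂ)

/-- The Specht module `V_lam`: the span of the polytabloids. -/
def Specht (lam : YoungDiagram) : Submodule ℂ ((Fin lam.card → ℕ) →₀ ℂ) :=
  Submodule.span ℂ (Set.range (polytabloid (lam := lam)))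

/-- Letters are permuted: `f ↦ f ∘ σ⁻¹` on row assignments. -/
def tabloidAction (k : ℕ) (σ : Perm (Fin k)) :
    ((Fin k → ℕ) →₀ ℂ) →ₗ[ℂ] ((Fin k → ℕ) →₀ ℂ) :=
  Finsupp.lmapDomain ℂ ℂ fun f => f ∘ σ.symm

theorem tabloidAction_polytabloid {lam : YoungDiagram} (σ : Perm (Fin lam.card))
    (t : Tableau lam) :
    tabloidAction lam.card σ (polytabloid t) = polytabloid (t.trans σ) := by
  simp only [polytabloid, tabloidAction, map_sum, map_smul, Finsupp.lmapDomain_apply,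
    Finsupp.mapDomain_single]
  rfl

theorem tabloidAction_mem {lam : YoungDiagram} (σ : Perm (Fin lam.card))
    (v : (Fin lam.card → ℕ) →₀ ℂ) (hv : v ∈ Specht lam) :
    tabloidAction lam.card σ v ∈ Specht lam := by
  have h : Specht lam ≤ (Specht lam).comap (tabloidAction lam.card σ) := by
    refine Submodule.span_le.2 ?_
    rintro _ ⟨t, rfl⟩
    change tabloidAction lam.card σ (polytabloid t) ∈ Specht lam
    rw [tabloidAction_polytabloid]
    exact Submodule.subset_span ⟨_, rfl⟩
  exact h hv

/-- The representation `ψ_lam` of the symmetric group on the Specht module `V_lam`. -/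
def spechtRep (lam : YoungDiagram) : Representation ℂ (Perm (Fin lam.card)) (Specht lam) where
  toFun σ := (tabloidAction lam.card σ).restrict (tabloidAction_mem σ)
  map_one' := by
    ext v : 2
    change tabloidAction lam.card 1 v.1 = v.1
    exact Finsupp.mapDomain_id
  map_mul' σ τ := by
    ext v : 2
    change tabloidAction lam.card (σ * τ) v.1
      = tabloidAction lam.card σ (tabloidAction lam.card τ v.1)
    exact Finsupp.mapDomain_comp (f := fun f : Fin lam.card → ℕ => f ∘ τ.symm)
      (g := fun f : Fin lam.card → ℕ => f ∘ σ.symm)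

/-! ### The group `G(n,1,r)` -/

/-- `G(n,1,r)`, the semidirect product of `𝒰_n ^ r` and `𝔖_r`, with
`(σ z σ⁻¹)_x = z_{σ⁻¹ x}`; the element `⟨z, σ⟩` is `(z;σ) = z σ`. -/
abbrev G (n r : ℕ) : Type :=
  (Fin r → rootsOfUnity n ℂ) ⋊[mulAutArrow] Perm (Fin r)

/-- The multipartition `(lam i)`, indexed by `i` modulo `n`, has total size `r`. -/
def IsMultipartition {n : ℕ} [NeZero n] (r : ℕ) (lam : ZMod n → YoungDiagram) : Prop :=
  ∑ i, (lam i).card = r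

/-! ### The irreducible representations of `G(n,1,r)` -/

section Rep

variable {n : ℕ} [NeZero n] {r : ℕ}

/-- The set `𝒳_c` of decompositions `(X_i)` of `{1,…,r}` with `|X_i| = c_i = |lam i|`;
such an `X` is encoded by the map that sends each point of `X_i` to `i`. -/
def Splitting (r : ℕ) (lam : ZMod n → YoungDiagram) : Type :=
  {f : Fin r → ZMod n // ∀ i, (Finset.univ.filter fun x => f x = i).card = (lam i).card}

variable {lam : ZMod n → YoungDiagram}

/-- The block `X_i`. -/
def Splitting.block (X : Splitting r lam) (i : ZMod n) : Finset (Fin r) :=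
  Finset.univ.filter fun x => X.1 x = i

theorem Splitting.mem_block (X : Splitting r lam) (i : ZMod n) (x : Fin r) :
    x ∈ X.block i ↔ X.1 x = i := by
  simp [Splitting.block]

/-- The increasing enumeration `x_{i,1} < ⋯ < x_{i,c_i}` of the block `X_i`. -/
def Splitting.enum (X : Splitting r lam) (i : ZMod n) : Fin (lam i).card ≃ X.block i :=
  ((X.block i).orderIsoOfFin (X.2 i)).toEquiv

/-- `σ X = (σ(X_0), …, σ(X_{n-1}))`. -/
def Splitting.perm (σ : Perm (Fin r)) (X : Splitting r lam) : Splitting r lam :=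
  ⟨fun x => X.1 (σ.symm x), fun i => by
    rw [← X.2 i]
    refine Finset.card_bij (fun x _ => σ.symm x) ?_ ?_ ?_
    · intro x hx
      simpa using hx
    · intro x _ y _ h
      exact σ.symm.injective h
    · intro y hy
      exact ⟨σ y, by simpa using hy, by simp⟩⟩

theorem Splitting.mem_block_perm (σ : Perm (Fin r)) (X : Splitting r lam) (i : ZMod n)
    (x : Fin r) : x ∈ X.block i ↔ σ x ∈ (X.perm σ).block i := by
  have h : (X.perm σ).1 (σ x) = X.1 x := congrArg X.1 (σ.symm_apply_apply x)
  rw [Splitting.mem_block, Splitting.mem_block, h]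

/-- The permutation `σ̃_i` of `{1,…,c_i}` with `σ(x_{i,j}) = y_{i,σ̃_i(j)}` for `Y = σ X`,
so that `σ t_X = t_{σ X} σ̃_0 ⋯ σ̃_{n-1}`. -/
def Splitting.rel (σ : Perm (Fin r)) (X : Splitting r lam) (i : ZMod n) :
    Perm (Fin (lam i).card) :=
  ((X.enum i).trans (σ.subtypeEquiv (X.mem_block_perm σ i))).trans ((X.perm σ).enum i).symm

theorem Splitting.perm_one (X : Splitting r lam) : X.perm 1 = X := rfl

theorem Splitting.perm_mul (σ τ : Perm (Fin r)) (X : Splitting r lam) :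
    X.perm (σ * τ) = (X.perm τ).perm σ := rfl

theorem Splitting.rel_one (X : Splitting r lam) (i : ZMod n) : X.rel 1 i = 1 := by
  ext j
  simp [Splitting.rel, Splitting.perm_one, Equiv.subtypeEquiv]

theorem Splitting.rel_mul (σ τ : Perm (Fin r)) (X : Splitting r lam) (i : ZMod n) :
    X.rel (σ * τ) i = (X.perm τ).rel σ i * X.rel τ i := by
  ext j
  simp [Splitting.rel, Splitting.perm_mul, Equiv.subtypeEquiv]

/-- The value `∏_i ∏_{x ∈ X_i} α^i(z_x)`, where `α` is the inclusion of `𝒰_n` in `ℂˣ`;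
this is `α_c(z_{t_X(1)}, …, z_{t_X(r)})`. -/
def Splitting.weight (X : Splitting r lam) (z : Fin r → rootsOfUnity n ℂ) : ℂ :=
  ∏ x, ((z x : ℂˣ) : ℂ) ^ (X.1 x).val

theorem Splitting.weight_one (X : Splitting r lam) : X.weight 1 = 1 := by
  simp [Splitting.weight]

theorem Splitting.weight_mul (X : Splitting r lam) (z w : Fin r → rootsOfUnity n ℂ) :
    X.weight (z * w) = X.weight z * X.weight w := by
  simp [Splitting.weight, mul_pow, Finset.prod_mul_distrib]

theorem Splitting.weight_perm (σ : Perm (Fin r)) (X : Splitting r lam)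
    (z : Fin r → rootsOfUnity n ℂ) :
    (X.perm σ).weight (mulAutArrow σ z) = X.weight z := by
  unfold Splitting.weight
  exact Equiv.prod_comp σ.symm fun x => ((z x : ℂˣ) : ℂ) ^ (X.1 x).val

variable (lam)

/-- The tensor product `V_lam = ⨂_i V_{lam i}` of Specht modules. -/
abbrev V : Type := ⨂[ℂ] i : ZMod n, Specht (lam i)

/-- The induced module `W_lam = Ind_{G_c}^G (V_lam) = ⨁_X t_X ⊗ V_lam`, where `X` runs over
`𝒳_c`; the vector `t_X ⊗ v` is `Finsupp.single X v`. -/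
abbrev W (r : ℕ) : Type := Splitting r lam →₀ V lam

/-- `z σ (t_X ⊗ (⨂ v_i)) = α_c(z_{t_{σX}(1)}, …, z_{t_{σX}(r)}) t_{σX} ⊗ (⨂ σ̃_i v_i)`. -/
def rhoFun (g : G n r) : W lam r →ₗ[ℂ] W lam r :=
  Finsupp.lsum ℂ fun X : Splitting r lam =>
    (X.perm g.right).weight g.left •
      (Finsupp.lsingle (X.perm g.right) ∘ₗ
        PiTensorProduct.map fun i => spechtRep (lam i) (X.rel g.right i))

theorem rhoFun_single (g : G n r) (X : Splitting r lam) (v : V lam) :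
    rhoFun lam g (Finsupp.single X v) = (X.perm g.right).weight g.left •
      Finsupp.single (X.perm g.right)
        (PiTensorProduct.map (fun i => spechtRep (lam i) (X.rel g.right i)) v) := by
  simp [rhoFun]

/-- The representation `ρ_lam` of `G(n,1,r)` on `W_lam`. -/
def rho (r : ℕ) : Representation ℂ (G n r) (W lam r) where
  toFun := rhoFun lam
  map_one' := by
    refine Finsupp.lhom_ext fun X v => ?_
    rw [rhoFun_single]
    simp [Splitting.perm_one, Splitting.rel_one, Splitting.weight_one, PiTensorProduct.map_one]
  map_mul' g h := by
    refine Finsupp.lhom_ext fun X v => ?_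
    rw [Module.End.mul_apply, rhoFun_single, rhoFun_single, map_smul, rhoFun_single]
    simp only [SemidirectProduct.mul_right, SemidirectProduct.mul_left, Splitting.weight_mul,
      Splitting.perm_mul, Splitting.rel_mul, Splitting.weight_perm, map_mul,
      PiTensorProduct.map_mul, Module.End.mul_apply]
    rw [smul_smul, mul_comm]

/-- The character of `ρ_lam`. -/
def chi (r : ℕ) (g : G n r) : ℂ := LinearMap.trace ℂ (W lam r) (rho lam r g)

end Rep

/-! ### Twisting by `ε` and the intertwiner -/

section Twist

/-- The linear character `ε` of `G(de,1,r)`, trivial on `𝔖_r` and equal to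
`α^d ⊗ ⋯ ⊗ α^d` on `𝒰_{de}^r`; its kernel is `G(de,e,r)`. -/
def eps (d e r : ℕ) : G (d * e) r →* ℂˣ where
  toFun g := (∏ x, (g.left x : ℂˣ)) ^ d
  map_one' := by simp
  map_mul' g h := by
    rw [← mul_pow]
    congr 1
    simp only [SemidirectProduct.mul_left, Pi.mul_apply, Subgroup.coe_mul,
      Finset.prod_mul_distrib]
    congr 1
    exact Equiv.prod_comp g.right.symm fun x => (h.left x : ℂˣ)

/-- `C_lam`: the powers `χ` of `ε` such that `χ ⊗ ρ_lam ≅ ρ_lam`. -/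
def C {d e : ℕ} [NeZero (d * e)] (lam : ZMod (d * e) → YoungDiagram) (r : ℕ) :
    Set (G (d * e) r →* ℂˣ) :=
  {χ | χ ∈ Subgroup.zpowers (eps d e r) ∧
    ∃ Φ : W lam r ≃ₗ[ℂ] W lam r, ∀ g v,
      Φ (((χ g : ℂˣ) : ℂ) • rho lam r g v) = rho lam r g (Φ v)}

variable {n : ℕ} [NeZero n] {r : ℕ}

/-- `m(X) = (X_a, X_{a+1}, …)`, indices modulo `n`. -/
def Splitting.shift {lam : ZMod n → YoungDiagram} (a : ZMod n)
    (h : ∀ i, lam (i + a) = lam i) (X : Splitting r lam) : Splitting r lam :=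
  ⟨fun x => X.1 x - a, fun i => by
    simp only [sub_eq_iff_eq_add]
    rw [X.2 (i + a), h i]⟩

/-- The rotation of tensor factors `⨂_i v_i ↦ ⨂_i v_{i+a}` of `V_lam`. -/
def rotate {lam : ZMod n → YoungDiagram} (a : ZMod n) (h : ∀ i, lam (i + a) = lam i) :
    V lam ≃ₗ[ℂ] V lam :=
  (PiTensorProduct.reindex ℂ (fun i => Specht (lam i)) (Equiv.subRight a)).trans
    (PiTensorProduct.congr fun i =>
      LinearEquiv.cast (R := ℂ) (M := fun μ : YoungDiagram => Specht μ) (h i))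

open Classical in
/-- The map `t_X ⊗ (⨂ v_i) ↦ t_{m(X)} ⊗ (⨂ v_{i+a})`; it makes sense when `lam` is invariant
under the shift by `a`, and is `0` by convention otherwise. -/
def intertwiner (lam : ZMod n → YoungDiagram) (r : ℕ) (a : ZMod n) : Module.End ℂ (W lam r) :=
  if h : ∀ i, lam (i + a) = lam i then
    Finsupp.lsum ℂ fun X : Splitting r lam =>
      Finsupp.lsingle (X.shift a h) ∘ₗ (rotate a h).toLinearMap
  else 0

/-- `Δ_{lam,k}(g) = Tr(M_lam ^ k ∘ ρ_lam(g))`, where `M_lam` is the intertwiner from `ρ_lam` to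
`ε ^ b ⊗ ρ_lam` that shifts by `d b`. -/
def Delta {d e : ℕ} [NeZero (d * e)] (lam : ZMod (d * e) → YoungDiagram) (r b k : ℕ)
    (g : G (d * e) r) : ℂ :=
  LinearMap.trace ℂ (W lam r)
    ((intertwiner lam r ((d * b : ℕ) : ZMod (d * e)) ^ k : Module.End ℂ (W lam r)) ∘ₗ rho lam r g)

/-- `(lam 0, …, lam (m-1), ∅, …, ∅)`. -/
def truncate (m : ℕ) (lam : ZMod n → YoungDiagram) : ZMod n → YoungDiagram :=
  fun i => if i.val < m then lam i else ⊥

end Twist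

/-! ### Cyclic structures and standard representatives -/

section Cycles

variable {n : ℕ} [NeZero n] {r : ℕ}

/-- The supports of the cycles of `σ`, cycles of length one included. -/
def cycles (σ : Perm (Fin r)) : Finset (Finset (Fin r)) :=
  Finset.univ.image fun x => Finset.univ.filter fun y => σ.SameCycle x y

/-- The cycle product of `g = (z;σ)` along a cycle of `σ` with support `c`. -/
def cycleProduct (g : G n r) (c : Finset (Fin r)) : rootsOfUnity n ℂ :=
  ∏ x ∈ c, g.left x

open Classical in
/-- The cyclic structure of `g` (with respect to the generator `ζ` of `𝒰_n`) is `eta`: the parts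
of `eta u` are the lengths of the cycles with cycle product `ζ ^ u`. -/
def HasCyclicStructure (ζ : rootsOfUnity n ℂ) (g : G n r) (eta : ZMod n → YoungDiagram) : Prop :=
  ∀ u, ((cycles g.right).filter fun c => cycleProduct g c = ζ ^ u.val).val.map Finset.card
    = ((eta u).rowLens : Multiset ℕ)

/-- A listing of all the parts of a multipartition `eta` of `r`, in some order: the `j`-th
listed part has length `len j` and belongs to `eta (col j)`. -/
structure PartListing (r : ℕ) (eta : ZMod n → YoungDiagram) where
  /-- the number of parts -/
  s : ℕ
  /-- the length of the `j`-th part -/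
  len : Fin s → ℕ
  /-- the component to which the `j`-th part belongs -/
  col : Fin s → ZMod n
  sum_len : ∑ j, len j = r
  parts : ∀ u, (Finset.univ.filter fun j => col j = u).val.map len
    = ((eta u).rowLens : Multiset ℕ)

variable {eta : ZMod n → YoungDiagram}

/-- The `k`-th letter of the `j`-th interval, when `{1,…,r}` is cut into successive intervals of
lengths `len 0, len 1, …`. -/
def PartListing.pos (L : PartListing r eta) : (Σ j : Fin L.s, Fin (L.len j)) ≃ Fin r :=
  finSigmaFinEquiv.trans (finCongr L.sum_len)

/-- The standard representative `g_eta = (z;σ)`: the cycles of `σ` are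
`(L_j + 1, L_j + 2, …, L_j + len j)`, and `z` is `ζ ^ (col j)` at the first letter `L_j + 1` of
the `j`-th cycle and `1` at its other letters. -/
def PartListing.rep (ζ : rootsOfUnity n ℂ) (L : PartListing r eta) : G n r :=
  ⟨fun x => if ((L.pos.symm x).2 : ℕ) = 0 then ζ ^ (L.col (L.pos.symm x).1).val else 1,
    L.pos.permCongr (Equiv.sigmaCongrRight fun j => finRotate (L.len j))⟩

/-- `pi = q ⋆ pi'`: the parts of `pi` are `q` times the parts of `pi'`. -/
def IsStar (q : ℕ) (pi' pi : YoungDiagram) : Prop :=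
  pi.rowLens = pi'.rowLens.map fun k => q * k

/-- The number of parts `ℓ(eta)` of a multipartition. -/
def numParts (eta : ZMod n → YoungDiagram) : ℕ := ∑ u, (eta u).rowLens.length

end Cycles

end WreathChar

end

/-! Put `n = d e` and `m = d b b'`. Since `ε` has order `e`, the group `C` has order `e / b`, so `n
= q m`; and `M ^ b'` is the intertwiner that shifts by `m`.

Regard a splitting `X` as a colouring of the letters by residues modulo `n`, and compute the trace
on the basis made of `t_X` tensored with products of basis vectors. Only those `X` contribute for
which the colour drops by `m` at each application of `σ`. Going once round a cycle of length `ℓ`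
gives `ℓ m ≡ 0` modulo `q m`, so `q ∣ ℓ`; if some cycle violates this, the trace is `0`. For a
contributing `X`, the operator on the tensor product acts on the factors and then rotates them. The
rotation has `m` orbits of `q` factors each, and each orbit yields the trace of the composite round
it, which is the character of `σ ^ q` on the block `X_i`, `0 ≤ i < m`
(`trace_intertwiner_comp_rho`).

Such an `X` is determined by the colours `i_j + k_j m` of the first letters of the cycles. The
letters of the `j`-th cycle lying in `X_{i_j}` form one cycle of `σ ^ q`, of length `ℓ_j / q`, so
the characters depend only on the `i_j`, while the weight of the cycle is `ξ_j ^ (i_j + (k_j + 1)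
m)`. Summing over `k_j` gives `q` if `ξ_j ^ m = 1` and `0` otherwise (`trace_eq_mul_cycleSum`). The
remaining sum over the `i_j` is `cycleSum`; the same formula for `q = 1` identifies it with the
character value at `g'` (`chi_truncate_eq_cycleSum`).

The invariance of the multipartition under the shift by `d b` has to be extracted from an abstract
isomorphism between `ρ` and `ε ^ b ⊗ ρ`. The diagonal subgroup matches the block `i` of the source
with the block `i + d b` of the target; column antisymmetrizers then give a dominance relation
between the two diagrams (`dominated_of_twist`), and running round the residues turns it into
equality. -/

noncomputable section

namespace WreathChar

/-! ### Column antisymmetrizers and the dominance order -/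

/-- The dominance order on Young diagrams: `mu` has at most as many boxes as `lam` in the first
`k` rows, for every `k`. -/
def Dominated (mu lam : YoungDiagram) : Prop :=
  ∀ k, (mu.cells.filter fun c => c.1 < k).card ≤ (lam.cells.filter fun c => c.1 < k).card

theorem Dominated.refl (mu : YoungDiagram) : Dominated mu mu := fun _ => le_rfl

theorem Dominated.trans {mu nu lam : YoungDiagram} (h : Dominated mu nu) (h' : Dominated nu lam) :
    Dominated mu lam := fun k => (h k).trans (h' k)

theorem card_filter_fst_lt_succ (mu : YoungDiagram) (k : ℕ) :
    (mu.cells.filter fun c => c.1 < k + 1).card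
      = (mu.cells.filter fun c => c.1 < k).card + mu.rowLen k := by
  rw [YoungDiagram.rowLen_eq_card, YoungDiagram.row, ← Finset.card_union_of_disjoint]
  · congr 1
    ext c
    simp only [Finset.mem_filter, Finset.mem_union]
    grind
  · rw [Finset.disjoint_left]
    intro c
    simp only [Finset.mem_filter]
    grind

theorem Dominated.antisymm {mu lam : YoungDiagram} (h : Dominated mu lam)
    (h' : Dominated lam mu) : mu = lam := by
  have hrow : ∀ k, mu.rowLen k = lam.rowLen k := fun k => by
    have h1 := le_antisymm (h k) (h' k)
    have h2 := le_antisymm (h (k + 1)) (h' (k + 1))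
    rw [card_filter_fst_lt_succ, card_filter_fst_lt_succ] at h2
    omega
  ext ⟨i, j⟩
  rw [YoungDiagram.mem_cells, YoungDiagram.mem_cells, YoungDiagram.mem_iff_lt_rowLen,
    YoungDiagram.mem_iff_lt_rowLen, hrow]

theorem mem_columnStabilizer {lam : YoungDiagram} {p : Perm lam.cells} :
    p ∈ columnStabilizer lam ↔ ∀ c, (p c).1.2 = c.1.2 := by
  simp [columnStabilizer]

theorem mul_mem_columnStabilizer {lam : YoungDiagram} {p p' : Perm lam.cells}
    (hp : p ∈ columnStabilizer lam) (hp' : p' ∈ columnStabilizer lam) :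
    p * p' ∈ columnStabilizer lam := by
  rw [mem_columnStabilizer] at *
  intro c
  rw [Equiv.Perm.mul_apply, hp, hp']

theorem inv_mem_columnStabilizer {lam : YoungDiagram} {p : Perm lam.cells}
    (hp : p ∈ columnStabilizer lam) : p⁻¹ ∈ columnStabilizer lam := by
  rw [mem_columnStabilizer] at *
  intro c
  rw [← hp (p⁻¹ c), ← Equiv.Perm.mul_apply, mul_inv_cancel, Equiv.Perm.one_apply]

theorem one_mem_columnStabilizer (lam : YoungDiagram) : 1 ∈ columnStabilizer lam :=
  mem_columnStabilizer.2 fun _ => rfl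

theorem swap_mem_columnStabilizer {lam : YoungDiagram} {c₁ c₂ : lam.cells}
    (h : c₁.1.2 = c₂.1.2) : Equiv.swap c₁ c₂ ∈ columnStabilizer lam := by
  rw [mem_columnStabilizer]
  intro c
  by_cases h1 : c = c₁
  · subst h1; simp [h]
  · by_cases h2 : c = c₂
    · subst h2; simp [h]
    · rw [Equiv.swap_apply_of_ne_of_ne h1 h2]

/-- The column antisymmetrizer of a filling `t` of `lam`, acting through a map `F` from the
symmetric group to a module. -/
def antisym {lam : YoungDiagram} {N : ℕ} (t : lam.cells ≃ Fin N) {M : Type*} [AddCommMonoid M]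
    [Module ℂ M] (F : Perm (Fin N) → M) : M :=
  ∑ p ∈ columnStabilizer lam, (((Perm.sign p : ℤˣ) : ℤ) : ℂ) • F (t.permCongr p)

theorem antisym_apply {lam : YoungDiagram} {N : ℕ} (t : lam.cells ≃ Fin N) {M M' : Type*}
    [AddCommMonoid M] [Module ℂ M] [AddCommMonoid M'] [Module ℂ M'] (F : Perm (Fin N) → M)
    (φ : M →ₗ[ℂ] M') : φ (antisym t F) = antisym t fun σ => φ (F σ) := by
  simp [antisym, map_sum]

/-- A column permutation multiplies `e_t` by its sign, so all terms of the sum agree. -/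
theorem antisym_polytabloid {lam : YoungDiagram} (t : Tableau lam) :
    antisym t (fun σ => tabloidAction lam.card σ (polytabloid t))
      = ((columnStabilizer lam).card : ℂ) • polytabloid t := by
  unfold antisym
  have key : ∀ p ∈ columnStabilizer lam, (((Perm.sign p : ℤˣ) : ℤ) : ℂ) •
      tabloidAction lam.card (t.permCongr p) (polytabloid t) = polytabloid t := by
    intro p hp
    rw [tabloidAction_polytabloid]
    unfold polytabloid
    rw [Finset.smul_sum]
    refine Finset.sum_bij (fun p' _ => p * p') ?_ ?_ ?_ ?_
    · exact fun p' hp' => mul_mem_columnStabilizer hp hp'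
    · exact fun _ _ _ _ h => mul_left_cancel h
    · exact fun p' hp' => ⟨p⁻¹ * p', mul_mem_columnStabilizer (inv_mem_columnStabilizer hp) hp',
        by simp⟩
    · intro p' _
      rw [smul_smul, Perm.sign_mul, Units.val_mul, Int.cast_mul]
      congr 3
      ext c
      simp [Equiv.permCongr]
  rw [Finset.sum_congr rfl key, Finset.sum_const, Nat.cast_smul_eq_nsmul]

/-- A permutation of the boxes that preserves both columns and rows is trivial, so `{t}` occurs only
once in `e_t`. In particular `e_t ≠ 0`. -/
theorem polytabloid_apply_tabloid {lam : YoungDiagram} (t : Tableau lam) :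
    polytabloid t (tabloid t) = 1 := by
  unfold polytabloid
  rw [Finsupp.finsetSum_apply, Finset.sum_eq_single_of_mem 1 (one_mem_columnStabilizer lam)]
  · have : tabloid (Equiv.trans (1 : Perm lam.cells) t) = tabloid t := rfl
    simp [this]
  · intro p hp hp1
    have hne : tabloid (p.trans t) ≠ tabloid t := by
      intro h
      refine hp1 (Equiv.ext fun c => ?_)
      have h1 := congrFun h (t (p c))
      simp only [tabloid, Equiv.symm_trans_apply, Equiv.symm_apply_apply] at h1
      exact Subtype.ext (Prod.ext h1.symm (mem_columnStabilizer.1 hp c))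
    simp [hne]

/-- Right multiplication by the transposition of `c₁` and `c₂` is a sign-reversing involution of the
column stabilizer that leaves the image of `f` unchanged. -/
theorem antisym_single_eq_zero {lam : YoungDiagram} {N : ℕ} (t : lam.cells ≃ Fin N)
    (f : Fin N → ℕ) {c₁ c₂ : lam.cells} (hne : c₁ ≠ c₂) (hcol : c₁.1.2 = c₂.1.2)
    (hf : f (t c₁) = f (t c₂)) :
    antisym t (fun σ => tabloidAction N σ (Finsupp.single f (1 : ℂ))) = 0 := by
  unfold antisym
  refine Finset.sum_involution (fun p _ => p * Equiv.swap c₁ c₂) ?_ ?_ ?_ ?_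
  · intro p _
    have hs : f ∘ (t.permCongr (p * Equiv.swap c₁ c₂)).symm = f ∘ (t.permCongr p).symm := by
      ext x
      have : (t.permCongr (p * Equiv.swap c₁ c₂)).symm x
          = t (Equiv.swap c₁ c₂ (p.symm (t.symm x))) := by
        rw [Equiv.symm_apply_eq]
        simp [Equiv.permCongr]
      have h2 : (t.permCongr p).symm x = t (p.symm (t.symm x)) := by
        rw [Equiv.symm_apply_eq]
        simp [Equiv.permCongr]
      simp only [Function.comp_apply, this, h2]
      generalize p.symm (t.symm x) = c
      by_cases h1 : c = c₁
      · subst h1; simp [hf]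
      · by_cases h2 : c = c₂
        · subst h2; simp [hf]
        · rw [Equiv.swap_apply_of_ne_of_ne h1 h2]
    simp only [tabloidAction, Finsupp.lmapDomain_apply, Finsupp.mapDomain_single, hs,
      Perm.sign_mul, Perm.sign_swap hne]
    simp
  · intro p _ _ h
    exact hne (Equiv.swap_eq_one_iff.1 (by simpa using h))
  · exact fun p hp => mul_mem_columnStabilizer hp (swap_mem_columnStabilizer hcol)
  · intro p _
    simp [mul_assoc]

/-- Counted column by column: a column of length at most `k` lies entirely in the first `k` rows,
and a longer one has `k` boxes there, but by injectivity at most `k` values below `k`. -/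
theorem card_filter_lt_le_of_injOn_columns {lam : YoungDiagram} {N : ℕ} (t : lam.cells ≃ Fin N)
    (f : Fin N → ℕ)
    (hf : ∀ c₁ c₂ : lam.cells, c₁.1.2 = c₂.1.2 → f (t c₁) = f (t c₂) → c₁ = c₂) (k : ℕ) :
    (Finset.univ.filter fun x => f x < k).card
      ≤ (lam.cells.filter fun c => c.1 < k).card := by
  classical
  have h1 : (Finset.univ.filter fun x => f x < k).card
      = (Finset.univ.filter fun c : lam.cells => f (t c) < k).card := by
    refine (Finset.card_bij (fun c _ => t c) ?_ ?_ ?_).symm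
    · intro c; simp
    · intro _ _ _ _ h; exact t.injective h
    · intro x hx; exact ⟨t.symm x, by simpa using hx, by simp⟩
  have h2 : (lam.cells.filter fun c => c.1 < k).card
      = (Finset.univ.filter fun c : lam.cells => c.1.1 < k).card := by
    refine (Finset.card_bij (fun c _ => c.1) ?_ ?_ ?_).symm
    · intro c; simp
    · intro _ _ _ _ h; exact Subtype.ext h
    · intro x hx
      rw [Finset.mem_filter] at hx
      exact ⟨⟨x, hx.1⟩, by simpa using hx.2, rfl⟩
  rw [h1, h2, Finset.card_eq_sum_card_fiberwise (f := fun c : lam.cells => c.1.2)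
      (t := Finset.univ.image fun c : lam.cells => c.1.2),
    Finset.card_eq_sum_card_fiberwise (f := fun c : lam.cells => c.1.2)
      (t := Finset.univ.image fun c : lam.cells => c.1.2)]
  rotate_left
  · intro c _; simp
  · intro c _; simp
  refine Finset.sum_le_sum fun j _ => ?_
  rw [Finset.filter_filter, Finset.filter_filter]
  rcases le_or_gt (lam.colLen j) k with hk | hk
  · refine Finset.card_le_card fun c hc => ?_
    simp only [Finset.mem_filter, Finset.mem_univ, true_and] at hc ⊢
    have hm : (c.1.1, j) ∈ lam := by
      rw [← hc.2]
      exact (YoungDiagram.mem_cells _).1 c.2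
    exact ⟨(YoungDiagram.mem_iff_lt_colLen.1 hm).trans_le hk, hc.2⟩
  · calc _ ≤ (Finset.range k).card := by
          refine Finset.card_le_card_of_injOn (fun c => f (t c)) ?_ ?_
          · intro c hc
            have hc' := (Finset.mem_filter.1 hc).2
            simpa using hc'.1
          · intro c hc c' hc' h
            have h1 := (Finset.mem_filter.1 hc).2
            have h2 := (Finset.mem_filter.1 hc').2
            exact hf c c' (h1.2.trans h2.2.symm) h
      _ ≤ _ := by
          refine Finset.card_le_card_of_surjOn (fun c => c.1.1) ?_
          intro i hi
          have hi' : i < k := by simpa using hi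
          have hm : (i, j) ∈ lam.cells :=
            (YoungDiagram.mem_cells _).2 (YoungDiagram.mem_iff_lt_colLen.2 (hi'.trans hk))
          exact ⟨⟨(i, j), hm⟩, by simpa using hi', rfl⟩

theorem card_filter_tabloid_lt {mu : YoungDiagram} (s : Tableau mu) (k : ℕ) :
    (Finset.univ.filter fun x => tabloid s x < k).card
      = (mu.cells.filter fun c => c.1 < k).card := by
  refine Finset.card_bij (fun x _ => (s.symm x).1) ?_ ?_ ?_
  · intro x hx
    have hx' : tabloid s x < k := by simpa using hx
    exact Finset.mem_filter.2 ⟨(s.symm x).2, hx'⟩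
  · intro _ _ _ _ h
    exact s.symm.injective (Subtype.ext h)
  · intro c hc
    rw [Finset.mem_filter] at hc
    exact ⟨s ⟨c, hc.1⟩, Finset.mem_filter.2 ⟨Finset.mem_univ _, by simpa [tabloid] using hc.2⟩, by simp⟩

/-- A column antisymmetrizer of shape `lam` that does not kill the Specht module of `mu`
forces `mu` to be dominated by `lam`. -/
theorem dominated_of_antisym_ne_zero {mu lam : YoungDiagram} (t : lam.cells ≃ Fin mu.card)
    (h : antisym t (fun σ => spechtRep mu σ) ≠ 0) : Dominated mu lam := by
  by_contra hd
  refine h (LinearMap.ext fun v => Subtype.ext ?_)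
  have happ : (antisym t (fun σ => spechtRep mu σ) v).1
      = antisym t (fun σ => tabloidAction mu.card σ) v.1 := by
    have h1 := antisym_apply t (fun σ => spechtRep mu σ)
      ((Specht mu).subtype ∘ₗ LinearMap.applyₗ v)
    have h2 := antisym_apply t (fun σ => tabloidAction mu.card σ) (LinearMap.applyₗ v.1)
    exact h1.trans h2.symm
  rw [happ]
  have hker : Specht mu ≤ LinearMap.ker (antisym t (fun σ => tabloidAction mu.card σ)) := by
    refine Submodule.span_le.2 ?_
    rintro _ ⟨s, rfl⟩
    rw [SetLike.mem_coe, LinearMap.mem_ker, polytabloid, map_sum]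
    refine Finset.sum_eq_zero fun p _ => ?_
    rw [map_smul]
    convert smul_zero _
    -- Failure of dominance forces two letters of one column of `t` into the same row of every
    -- tabloid of shape `mu`, and such a tabloid is killed.
    have hc : ¬ ∀ c₁ c₂ : lam.cells, c₁.1.2 = c₂.1.2 →
        tabloid (p.trans s) (t c₁) = tabloid (p.trans s) (t c₂) → c₁ = c₂ := by
      intro hc
      refine hd fun k => ?_
      rw [← card_filter_tabloid_lt (p.trans s)]
      exact card_filter_lt_le_of_injOn_columns t _ hc k
    push Not at hc
    obtain ⟨c₁, c₂, hcol, hf, hne⟩ := hc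
    exact (antisym_apply t (fun σ => tabloidAction mu.card σ)
      (LinearMap.applyₗ (Finsupp.single (tabloid (p.trans s)) (1 : ℂ)))).trans
      (antisym_single_eq_zero t _ hne hcol hf)
  exact LinearMap.mem_ker.1 (hker v.2)

/-! ### Bases of Specht modules -/

theorem exists_fin_basis_submodule {K M : Type*} [Field K] [AddCommGroup M] [Module K M]
    (S : Submodule K M) [Module.Finite K S] : ∃ N, Nonempty (Module.Basis (Fin N) K S) :=
  ⟨_, ⟨Module.finBasis K S⟩⟩

theorem exists_spechtBasis (mu : YoungDiagram) :
    ∃ N, Nonempty (Module.Basis (Fin N) ℂ (Specht mu)) := by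
  have h : Module.Finite ℂ (Specht mu) :=
    Module.Finite.iff_fg.2 (Submodule.fg_span (Set.finite_range _))
  exact exists_fin_basis_submodule (Specht mu)

/-- The dimension of the Specht module. -/
def spechtDim (mu : YoungDiagram) : ℕ := (exists_spechtBasis mu).choose

/-- A basis of the Specht module. -/
def spechtBasis (mu : YoungDiagram) : Module.Basis (Fin (spechtDim mu)) ℂ (Specht mu) :=
  (exists_spechtBasis mu).choose_spec.some

/-- A basis of the tensor product of the Specht modules. -/
def tensorBasis {n : ℕ} [NeZero n] (lam : ZMod n → YoungDiagram) :
    Module.Basis (∀ i, Fin (spechtDim (lam i))) ℂ (V lam) :=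
  Basis.piTensorProduct fun i => spechtBasis (lam i)

theorem smul_cancel_of_basis {K M ι : Type*} [Field K] [AddCommMonoid M] [Module K M]
    (B : Module.Basis ι K M) {a b : K} {v : M} (hv : v ≠ 0) (h : a • v = b • v) : a = b := by
  obtain ⟨p, hp⟩ : ∃ p, B.repr v p ≠ 0 := by
    by_contra! hp
    exact hv (B.ext_elem fun i => by simp [hp])
  have h1 := congrArg (fun w => B.repr w p) h
  simp only [map_smul, Finsupp.smul_apply, smul_eq_mul] at h1
  exact mul_right_cancel₀ hp h1

/-! ### The action on splittings -/

section Action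

variable {n : ℕ} [NeZero n] {r : ℕ} {lam : ZMod n → YoungDiagram}

theorem Splitting.ext {X Y : Splitting r lam} (h : ∀ x, X.1 x = Y.1 x) : X = Y :=
  Subtype.ext (funext h)

theorem Splitting.perm_injective (σ : Perm (Fin r)) :
    Function.Injective (Splitting.perm σ : Splitting r lam → Splitting r lam) := by
  intro X Y h
  refine Splitting.ext fun x => ?_
  have := congrFun (congrArg Subtype.val h) (σ x)
  simpa [Splitting.perm] using this

theorem Splitting.enum_rel (σ : Perm (Fin r)) (X : Splitting r lam) (i : ZMod n)
    (j : Fin (lam i).card) :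
    (((X.perm σ).enum i (X.rel σ i j) : (X.perm σ).block i) : Fin r) = σ (X.enum i j) := by
  simp [Splitting.rel, Equiv.subtypeEquiv]

theorem Splitting.enum_rel_of_perm_eq {σ : Perm (Fin r)} {X : Splitting r lam}
    (hX : X.perm σ = X) (i : ZMod n) (j : Fin (lam i).card) :
    ((X.enum i (X.rel σ i j) : X.block i) : Fin r) = σ (X.enum i j) := by
  have h := X.enum_rel σ i j
  rwa [hX] at h

theorem rho_apply_perm (g : G n r) (w : W lam r) (Y : Splitting r lam) :
    rho lam r g w (Y.perm g.right) = (Y.perm g.right).weight g.left •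
      PiTensorProduct.map (fun i => spechtRep (lam i) (Y.rel g.right i)) (w Y) := by
  induction w using Finsupp.induction_linear with
  | zero => simp
  | add f g hf hg => rw [map_add, Finsupp.add_apply, hf, hg, Finsupp.add_apply, map_add, smul_add]
  | single X v =>
    change rhoFun lam g _ _ = _
    rw [rhoFun_single, Finsupp.smul_apply]
    by_cases h : X = Y
    · subst h
      simp
    · have h' : X.perm g.right ≠ Y.perm g.right := fun h' => h (Splitting.perm_injective _ h')
      rw [Finsupp.single_eq_of_ne h'.symm, Finsupp.single_eq_of_ne (Ne.symm h)]
      simp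

theorem rho_single (g : G n r) (X : Splitting r lam) (v : V lam) :
    rho lam r g (Finsupp.single X v) = (X.perm g.right).weight g.left •
      Finsupp.single (X.perm g.right)
        (PiTensorProduct.map (fun i => spechtRep (lam i) (X.rel g.right i)) v) :=
  rhoFun_single lam g X v

theorem exists_splitting (hlam : IsMultipartition r lam) : Nonempty (Splitting r lam) := by
  have hc : Fintype.card (Σ i : ZMod n, Fin (lam i).card) = Fintype.card (Fin r) := by
    simp only [Fintype.card_sigma, Fintype.card_fin]
    exact hlam
  let e := Fintype.equivOfCardEq hc
  refine ⟨⟨fun x => (e.symm x).1, fun i => ?_⟩⟩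
  rw [← Fintype.card_fin (lam i).card, ← Finset.card_univ]
  refine (Finset.card_bij (fun j _ => e ⟨i, j⟩) ?_ ?_ ?_).symm
  · intro j _; simp
  · intro _ _ _ _ h
    simpa using e.injective h
  · intro x hx
    rw [Finset.mem_filter] at hx
    obtain ⟨⟨i', j⟩, rfl⟩ := e.surjective x
    obtain rfl : i' = i := by simpa using hx.2
    exact ⟨j, by simp, rfl⟩

instance (mu : YoungDiagram) : Nonempty (Tableau mu) :=
  ⟨Fintype.equivFinOfCardEq (by simp [YoungDiagram.card])⟩

theorem tprod_polytabloid_ne_zero (t : ∀ i, Tableau (lam i)) :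
    (PiTensorProduct.tprod ℂ fun i =>
      (⟨polytabloid (t i), Submodule.subset_span ⟨t i, rfl⟩⟩ : Specht (lam i))) ≠ 0 := by
  intro h
  have h1 := congrArg (PiTensorProduct.lift
    ((MultilinearMap.mkPiAlgebra ℂ (ZMod n) ℂ).compLinearMap fun i =>
      (Finsupp.lapply (tabloid (t i))) ∘ₗ (Specht (lam i)).subtype)) h
  simp [polytabloid_apply_tabloid] at h1

/-- A permutation of the letters `1, …, c_i`, made to act on the block `X_i`. -/
def Splitting.blockPerm (X : Splitting r lam) (i : ZMod n) (τ : Perm (Fin (lam i).card)) :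
    Perm (Fin r) :=
  τ.extendDomain (X.enum i)

theorem Splitting.blockPerm_enum (X : Splitting r lam) (i : ZMod n)
    (τ : Perm (Fin (lam i).card)) (j : Fin (lam i).card) :
    X.blockPerm i τ (X.enum i j) = X.enum i (τ j) :=
  Equiv.Perm.extendDomain_apply_image _ _ _

theorem Splitting.blockPerm_of_ne (X : Splitting r lam) (i : ZMod n)
    (τ : Perm (Fin (lam i).card)) {x : Fin r} (hx : X.1 x ≠ i) : X.blockPerm i τ x = x :=
  Equiv.Perm.extendDomain_apply_not_subtype _ _ fun h => hx ((X.mem_block i x).1 h)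

theorem Splitting.apply_blockPerm (X : Splitting r lam) (i : ZMod n)
    (τ : Perm (Fin (lam i).card)) (x : Fin r) : X.1 (X.blockPerm i τ x) = X.1 x := by
  by_cases hx : X.1 x = i
  · obtain ⟨j, hj⟩ := (X.enum i).surjective ⟨x, (X.mem_block i x).2 hx⟩
    have hj' : (X.enum i j : Fin r) = x := by rw [hj]
    rw [hx, ← hj', X.blockPerm_enum]
    exact (X.mem_block i _).1 (X.enum i (τ j)).2
  · rw [X.blockPerm_of_ne i τ hx]

theorem Splitting.perm_eq_self {σ : Perm (Fin r)} {X : Splitting r lam}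
    (h : ∀ x, X.1 (σ x) = X.1 x) : X.perm σ = X :=
  Splitting.ext fun x => by
    have := h (σ.symm x)
    rw [Equiv.apply_symm_apply] at this
    exact this.symm

theorem Splitting.rel_eq_one {σ : Perm (Fin r)} {X : Splitting r lam} (hX : X.perm σ = X)
    {i : ZMod n} (h : ∀ x, X.1 x = i → σ x = x) : X.rel σ i = 1 := by
  ext1 j
  apply (X.enum i).injective
  apply Subtype.ext
  rw [X.enum_rel_of_perm_eq hX, h _ ((X.mem_block i _).1 (X.enum i j).2), Equiv.Perm.one_apply]

theorem antisym_comp_linear {mu : YoungDiagram} {N N' : ℕ} (t : mu.cells ≃ Fin N)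
    (e : Fin N ≃ Fin N') {M M' : Type*}
    [AddCommMonoid M] [Module ℂ M] [AddCommMonoid M'] [Module ℂ M']
    (F : Perm (Fin N) → M') (F' : Perm (Fin N') → M) (φ : M →ₗ[ℂ] M')
    (h : ∀ τ, F τ = φ (F' (e.permCongr τ))) :
    antisym t F = φ (antisym (t.trans e) F') := by
  rw [antisym_apply]
  exact Finset.sum_congr rfl fun p _ => by rw [h]; rfl

/-- Let `t_Y` occur in the image of `t_X ⊗ v₀`, with `v₀` a tensor of polytabloids. Then the blocks
`X_{i₀}` and `Y_{i₀ + k}` coincide as sets, and the permutations of this set act on the two sides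
through the Specht modules of `lam i₀` and `lam (i₀ + k)`. The column antisymmetrizer of shape `lam
i₀` does not kill `v₀`, hence it does not vanish on the second Specht module. -/
theorem dominated_of_twist {ζ : rootsOfUnity n ℂ} (hζ : IsPrimitiveRoot ζ n)
    (hlam : IsMultipartition r lam) (k : ℕ) (Φ : W lam r ≃ₗ[ℂ] W lam r)
    (hΦ : ∀ (g : G n r) v, Φ ((∏ x, ((g.left x : ℂˣ) : ℂ)) ^ k • rho lam r g v)
      = rho lam r g (Φ v)) (i₀ : ZMod n) :
    Dominated (lam (i₀ + k)) (lam i₀) := by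
  classical
  obtain ⟨X⟩ := exists_splitting hlam
  let t : ∀ i, Tableau (lam i) := fun i => Classical.arbitrary _
  set p : ∀ i, Specht (lam i) :=
    fun i => ⟨polytabloid (t i), Submodule.subset_span ⟨t i, rfl⟩⟩ with hp
  set v₀ : V lam := PiTensorProduct.tprod ℂ p with hv₀
  have hne : Φ (Finsupp.single X v₀) ≠ 0 := by
    rw [Ne, LinearEquiv.map_eq_zero_iff, Finsupp.single_eq_zero]
    exact tprod_polytabloid_ne_zero t
  obtain ⟨Y, hY⟩ := Finsupp.ne_iff.1 hne
  rw [Finsupp.zero_apply] at hY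
  -- Compare the eigenvalues of the diagonal element with `ζ` at `x` and `1` elsewhere: they are `ζ
  -- ^ (k + X x)` on the source and `ζ ^ (Y x)` on the target.
  have hYX : ∀ x, Y.1 x = X.1 x + k := by
    intro x
    set z : Fin r → rootsOfUnity n ℂ := Pi.mulSingle x ζ with hz
    have h := congrArg (fun w : W lam r => w (Y.perm 1)) (hΦ ⟨z, 1⟩ (Finsupp.single X v₀))
    have h1 := rho_apply_perm ⟨z, 1⟩ (Φ (Finsupp.single X v₀)) Y
    have hw : ∀ X : Splitting r lam, X.weight z = ((ζ : ℂˣ) : ℂ) ^ (X.1 x).val := by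
      intro X
      unfold Splitting.weight
      rw [Finset.prod_eq_single x]
      · simp [hz]
      · intro y _ hy; simp [hz, hy]
      · simp
    have hprod : ∏ y, ((z y : ℂˣ) : ℂ) = ((ζ : ℂˣ) : ℂ) := by
      rw [Finset.prod_eq_single x]
      · simp [hz]
      · intro y _ hy; simp [hz, hy]
      · simp
    simp only [rho_single, hprod] at h
    rw [h1] at h
    simp only [Splitting.perm_one, Splitting.rel_one, map_one, PiTensorProduct.map_one,
      Module.End.one_apply, hw, map_smul, Finsupp.smul_apply, smul_smul] at h
    have h2 := smul_cancel_of_basis (tensorBasis lam) hY h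
    rw [← pow_add] at h2
    have h3 : ζ ^ (k + (X.1 x).val) = ζ ^ (Y.1 x).val := by
      apply Subtype.ext
      apply Units.ext
      simpa using h2
    rw [pow_eq_pow_iff_modEq, ← hζ.eq_orderOf, ← ZMod.natCast_eq_natCast_iff] at h3
    simp only [Nat.cast_add, ZMod.natCast_val, ZMod.cast_id', id_eq] at h3
    rw [← h3, add_comm]
  set j₀ := i₀ + (k : ZMod n) with hj₀
  have hblock : ∀ x, x ∈ X.block i₀ ↔ x ∈ Y.block j₀ := by
    intro x
    rw [X.mem_block, Y.mem_block, hYX, hj₀, add_left_inj]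
  let e : Fin (lam i₀).card ≃ Fin (lam j₀).card :=
    ((X.enum i₀).trans (Equiv.subtypeEquivRight hblock)).trans (Y.enum j₀).symm
  have he : ∀ j, (Y.enum j₀ (e j) : Fin r) = X.enum i₀ j := by
    intro j
    simp [e]
  refine dominated_of_antisym_ne_zero ((t i₀).trans e) fun h0 => hY ?_
  let S : Perm (Fin (lam i₀).card) → Perm (Fin r) := X.blockPerm i₀
  have hXS : ∀ τ, X.perm (S τ) = X := fun τ =>
    Splitting.perm_eq_self (X.apply_blockPerm i₀ τ)
  have hYS : ∀ τ, Y.perm (S τ) = Y := fun τ =>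
    Splitting.perm_eq_self fun x => by rw [hYX, hYX, X.apply_blockPerm i₀ τ]
  have hXrel : ∀ τ, X.rel (S τ) i₀ = τ := by
    intro τ
    ext1 j
    apply (X.enum i₀).injective
    apply Subtype.ext
    rw [X.enum_rel_of_perm_eq (hXS τ), X.blockPerm_enum]
  have hXrel' : ∀ τ i, i ≠ i₀ → X.rel (S τ) i = 1 := fun τ i hi =>
    Splitting.rel_eq_one (hXS τ) fun x hx => X.blockPerm_of_ne i₀ τ (by rwa [hx])
  have hYrel : ∀ τ, Y.rel (S τ) j₀ = e.permCongr τ := by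
    intro τ
    ext1 j
    apply (Y.enum j₀).injective
    apply Subtype.ext
    obtain ⟨j, rfl⟩ := e.surjective j
    rw [Y.enum_rel_of_perm_eq (hYS τ), he, X.blockPerm_enum, ← he]
    simp
  have hYrel' : ∀ τ i, i ≠ j₀ → Y.rel (S τ) i = 1 := fun τ i hi =>
    Splitting.rel_eq_one (hYS τ) fun x hx => X.blockPerm_of_ne i₀ τ fun hx' => hi (by
      rw [← hx, hYX, hx'])
  let B : V lam →ₗ[ℂ] V lam := Finsupp.lapply Y ∘ₗ Φ.toLinearMap ∘ₗ Finsupp.lsingle X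
  have hB : ∀ τ v, B (PiTensorProduct.map (fun i => spechtRep (lam i) (X.rel (S τ) i)) v)
      = PiTensorProduct.map (fun i => spechtRep (lam i) (Y.rel (S τ) i)) (B v) := by
    intro τ v
    have h := congrArg (fun w : W lam r => w (Y.perm (S τ)))
      (hΦ ⟨1, S τ⟩ (Finsupp.single X v))
    have h1 := rho_apply_perm ⟨1, S τ⟩ (Φ (Finsupp.single X v)) Y
    simp only [rho_single] at h
    rw [h1] at h
    simpa [Splitting.weight_one, hXS, hYS, B] using h
  have hXmap : ∀ τ, PiTensorProduct.map (fun i => spechtRep (lam i) (X.rel (S τ) i)) v₀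
      = (PiTensorProduct.tprod ℂ).toLinearMap p i₀ (spechtRep (lam i₀) τ (p i₀)) := by
    intro τ
    rw [hv₀, PiTensorProduct.map_tprod, MultilinearMap.toLinearMap_apply]
    congr 1
    ext1 i
    by_cases hi : i = i₀
    · subst hi
      rw [Function.update_self, hXrel]
    · rw [Function.update_of_ne hi, hXrel' τ i hi, map_one, Module.End.one_apply]
  have hYmap : ∀ τ, PiTensorProduct.map (fun i => spechtRep (lam i) (Y.rel (S τ) i)) (B v₀)
      = (LinearMap.applyₗ (B v₀) ∘ₗ (PiTensorProduct.mapMultilinear ℂ (fun i => Specht (lam i))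
        (fun i => Specht (lam i))).toLinearMap (fun _ => LinearMap.id) j₀)
          (spechtRep (lam j₀) (e.permCongr τ)) := by
    intro τ
    generalize B v₀ = w
    rw [LinearMap.comp_apply, MultilinearMap.toLinearMap_apply, LinearMap.applyₗ_apply_apply,
      PiTensorProduct.mapMultilinear_apply]
    congr 2
    ext1 i
    by_cases hi : i = j₀
    · subst hi
      rw [Function.update_self, hYrel]
    · rw [Function.update_of_ne hi, hYrel' τ i hi, map_one]
      rfl
  -- The antisymmetrized sum of `B (S τ v₀)` is evaluated twice: through the target it is `0` by
  -- `h0`, through the source it is a nonzero multiple of `B v₀`.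
  have hsum : antisym (t i₀)
      (fun τ => B (PiTensorProduct.map (fun i => spechtRep (lam i) (X.rel (S τ) i)) v₀)) = 0 := by
    simp only [hB]
    rw [antisym_comp_linear (t i₀) e _ _ _ hYmap, h0, map_zero]
  have hsum' : antisym (t i₀) (fun τ => spechtRep (lam i₀) τ (p i₀))
      = ((columnStabilizer (lam i₀)).card : ℂ) • p i₀ := by
    apply Subtype.ext
    exact (antisym_apply (t i₀) (fun τ => spechtRep (lam i₀) τ (p i₀))
      (Specht (lam i₀)).subtype).trans (antisym_polytabloid (t i₀))
  rw [← antisym_apply (t i₀) _ B] at hsum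
  simp only [hXmap] at hsum
  rw [← antisym_apply (t i₀), hsum', map_smul, map_smul, smul_eq_zero] at hsum
  have hcard : ((columnStabilizer (lam i₀)).card : ℂ) ≠ 0 :=
    Nat.cast_ne_zero.2 (Finset.card_ne_zero_of_mem (one_mem_columnStabilizer _))
  have h2 := hsum.resolve_left hcard
  rw [MultilinearMap.toLinearMap_apply, Function.update_eq_self] at h2
  exact h2

/-- Repeated shifts by `k` return to `i`, so the chain of dominance relations closes up, and
dominance is antisymmetric. -/
theorem shift_invariant_of_twist {ζ : rootsOfUnity n ℂ} (hζ : IsPrimitiveRoot ζ n)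
    (hlam : IsMultipartition r lam) (k : ℕ) (Φ : W lam r ≃ₗ[ℂ] W lam r)
    (hΦ : ∀ (g : G n r) v, Φ ((∏ x, ((g.left x : ℂˣ) : ℂ)) ^ k • rho lam r g v)
      = rho lam r g (Φ v)) (i : ZMod n) :
    lam (i + k) = lam i := by
  have hd := dominated_of_twist hζ hlam k Φ hΦ
  refine (hd i).antisymm ?_
  have h : ∀ l : ℕ, Dominated (lam (i + k + l * k)) (lam (i + k)) := by
    intro l
    induction l with
    | zero => simpa using Dominated.refl _
    | succ l ih =>
      refine Dominated.trans ?_ ih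
      convert hd (i + k + l * k) using 2
      push_cast
      ring
  -- Modulo `n`, `i + k + (n - 1) k = i`.
  convert h (n - 1) using 2
  rw [Nat.cast_sub NeZero.one_le]
  simp

end Action

/-! ### The order of `ε` and the period of the multipartition -/

section Period

variable {d e r : ℕ} [NeZero (d * e)]

/-- The element with `ζ` at one letter and `1` elsewhere is sent to `ζ ^ d`, which already has order
`e`. -/
theorem orderOf_eps (hd : 0 < d) (hr : 0 < r) {ζ : rootsOfUnity (d * e) ℂ}
    (hζ : IsPrimitiveRoot ζ (d * e)) : orderOf (eps d e r) = e := by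
  refine Nat.dvd_antisymm (orderOf_dvd_of_pow_eq_one ?_) ?_
  · ext1 g
    change (((∏ x, (g.left x : ℂˣ)) ^ d) ^ e : ℂˣ) = 1
    rw [← pow_mul, ← Finset.prod_pow]
    exact Finset.prod_eq_one fun x _ => (mem_rootsOfUnity _ _).1 (g.left x).2
  · have h := DFunLike.congr_fun (pow_orderOf_eq_one (eps d e r))
      (⟨Pi.mulSingle ⟨0, hr⟩ ζ, 1⟩ : G (d * e) r)
    change ((∏ x, ((Pi.mulSingle ⟨0, hr⟩ ζ : Fin r → rootsOfUnity (d * e) ℂ) x : ℂˣ)) ^ d)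
      ^ orderOf (eps d e r) = 1 at h
    rw [Finset.prod_eq_single ⟨0, hr⟩ (by intro y _ hy; simp [hy]) (by simp), ← pow_mul,
      Pi.mulSingle_eq_same] at h
    have h1 : ζ ^ (d * orderOf (eps d e r)) = 1 := Subtype.ext h
    exact Nat.dvd_of_mul_dvd_mul_left hd (hζ.dvd_of_pow_eq_one _ h1)

theorem eq_mul_of_ncard (hd : 0 < d) (he : 0 < e) (hr : 0 < r) {ζ : rootsOfUnity (d * e) ℂ}
    (hζ : IsPrimitiveRoot ζ (d * e)) {b N : ℕ} (hb : b ∣ e)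
    (hN : (Subgroup.zpowers (eps d e r ^ b) : Set (G (d * e) r →* ℂˣ)).ncard = N) :
    e = b * N := by
  have h1 : (Subgroup.zpowers (eps d e r ^ b) : Set (G (d * e) r →* ℂˣ)).ncard
      = orderOf (eps d e r ^ b) := by
    rw [← Nat.card_zpowers, ← Nat.card_coe_set_eq]
    rfl
  have hb0 : b ≠ 0 := by
    rintro rfl
    exact he.ne' (Nat.eq_zero_of_zero_dvd hb)
  rw [h1, orderOf_pow_of_dvd hb0 (by rwa [orderOf_eps hd hr hζ]), orderOf_eps hd hr hζ] at hN
  rw [← hN, Nat.mul_div_cancel' hb]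

theorem shift_invariant_of_mem_C {ζ : rootsOfUnity (d * e) ℂ}
    (hζ : IsPrimitiveRoot ζ (d * e)) {lam : ZMod (d * e) → YoungDiagram}
    (hlam : IsMultipartition r lam) {b : ℕ} (hb : eps d e r ^ b ∈ C lam r) (i : ZMod (d * e)) :
    lam (i + (d * b : ℕ)) = lam i := by
  obtain ⟨-, Φ, hΦ⟩ := hb
  refine shift_invariant_of_twist hζ hlam (d * b) Φ (fun g v => ?_) i
  rw [← hΦ]
  have : (((eps d e r ^ b) g : ℂˣ) : ℂ) = (∏ x, ((g.left x : ℂˣ) : ℂ)) ^ (d * b) := by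
    change ((((∏ x, (g.left x : ℂˣ)) ^ d) ^ b : ℂˣ) : ℂ) = _
    rw [← pow_mul]
    simp
  rw [this]

end Period

/-! ### Intertwiners -/

section Intertwiner

variable {n : ℕ} [NeZero n] {r : ℕ} {lam : ZMod n → YoungDiagram}

/-- Heterogeneous equality lets the transports along equalities of diagrams be composed and
cancelled when rotations are multiplied. -/
theorem spechtCast_heq {mu nu : YoungDiagram} (h : mu = nu) (v : Specht mu) :
    HEq (LinearEquiv.cast (R := ℂ) (M := fun μ : YoungDiagram => Specht μ) h v) v := by
  subst h
  rfl

theorem rotate_tprod (a : ZMod n) (h : ∀ i, lam (i + a) = lam i) (v : ∀ i, Specht (lam i)) :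
    rotate a h (PiTensorProduct.tprod ℂ v) = PiTensorProduct.tprod ℂ fun i =>
      LinearEquiv.cast (R := ℂ) (M := fun μ : YoungDiagram => Specht μ) (h i) (v (i + a)) := by
  unfold rotate
  rw [LinearEquiv.trans_apply, PiTensorProduct.reindex_tprod]
  exact PiTensorProduct.congr_tprod _ _

theorem intertwiner_single (a : ZMod n) (h : ∀ i, lam (i + a) = lam i) (X : Splitting r lam)
    (v : V lam) : intertwiner lam r a (Finsupp.single X v)
      = Finsupp.single (X.shift a h) (rotate a h v) := by
  simp [intertwiner, h]

theorem end_ext {f f' : Module.End ℂ (W lam r)}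
    (h : ∀ X (v : ∀ i, Specht (lam i)), f (Finsupp.single X (PiTensorProduct.tprod ℂ v))
      = f' (Finsupp.single X (PiTensorProduct.tprod ℂ v))) : f = f' := by
  refine Finsupp.lhom_ext' fun X => PiTensorProduct.ext (MultilinearMap.ext fun v => ?_)
  exact h X v

theorem intertwiner_zero : intertwiner lam r 0 = 1 := by
  have h0 : ∀ i, lam (i + 0) = lam i := fun i => by rw [add_zero]
  refine end_ext fun X v => ?_
  rw [intertwiner_single 0 h0, rotate_tprod, Module.End.one_apply]
  congr 1
  · exact Splitting.ext fun x => sub_zero _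
  · congr 1
    ext1 i
    apply eq_of_heq
    refine (spechtCast_heq _ _).trans ?_
    rw [add_zero]

theorem intertwiner_mul (a a' : ZMod n) (h : ∀ i, lam (i + a) = lam i)
    (h' : ∀ i, lam (i + a') = lam i) :
    intertwiner lam r a * intertwiner lam r a' = intertwiner lam r (a + a') := by
  have h2 : ∀ i, lam (i + (a + a')) = lam i := fun i => by rw [← add_assoc, h', h]
  refine end_ext fun X v => ?_
  rw [Module.End.mul_apply, intertwiner_single a' h', intertwiner_single a h,
    intertwiner_single _ h2, rotate_tprod, rotate_tprod, rotate_tprod]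
  congr 1
  · exact Splitting.ext fun x => by
      change X.1 x - a' - a = X.1 x - (a + a')
      ring
  · congr 1
    ext1 i
    apply eq_of_heq
    refine (spechtCast_heq _ _).trans ((spechtCast_heq _ _).trans ?_)
    refine HEq.trans ?_ (spechtCast_heq _ _).symm
    rw [add_assoc]

theorem intertwiner_pow (a : ZMod n) (h : ∀ i, lam (i + a) = lam i) (k : ℕ) :
    intertwiner lam r a ^ k = intertwiner lam r (k * a) := by
  induction k with
  | zero => rw [pow_zero, Nat.cast_zero, zero_mul, intertwiner_zero]
  | succ k ih =>
    have hk : ∀ k : ℕ, ∀ i, lam (i + k * a) = lam i := by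
      intro k
      induction k with
      | zero => simp
      | succ k ih =>
        intro i
        rw [Nat.cast_add, Nat.cast_one, add_mul, one_mul, ← add_assoc, h, ih]
    rw [pow_succ, ih, intertwiner_mul _ _ (hk k) h]
    push_cast
    congr 1
    ring

end Intertwiner

/-! ### Matrices and characters of Specht modules -/

section Character

/-- The character of the Specht module. -/
def spechtChar (mu : YoungDiagram) (τ : Perm (Fin mu.card)) : ℂ :=
  LinearMap.trace ℂ (Specht mu) (spechtRep mu τ)

/-- The matrix of `τ` on the Specht module, padded by zeros to size `N`. -/
def spechtMatrix (N : ℕ) (mu : YoungDiagram) (τ : Perm (Fin mu.card)) :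
    Matrix (Fin N) (Fin N) ℂ := fun x y =>
  if h : (x : ℕ) < spechtDim mu ∧ (y : ℕ) < spechtDim mu then
    (spechtBasis mu).repr (spechtRep mu τ (spechtBasis mu ⟨y, h.2⟩)) ⟨x, h.1⟩
  else 0

theorem spechtMatrix_castLE {N : ℕ} {mu : YoungDiagram} (hN : spechtDim mu ≤ N)
    (τ : Perm (Fin mu.card)) (x y : Fin (spechtDim mu)) :
    spechtMatrix N mu τ (Fin.castLE hN x) (Fin.castLE hN y)
      = (spechtBasis mu).repr (spechtRep mu τ (spechtBasis mu y)) x := by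
  simp [spechtMatrix]

theorem spechtMatrix_eq_zero_left {N : ℕ} {mu : YoungDiagram} (τ : Perm (Fin mu.card))
    {x : Fin N} (y : Fin N) (hx : ¬ (x : ℕ) < spechtDim mu) : spechtMatrix N mu τ x y = 0 := by
  simp [spechtMatrix, hx]

theorem spechtMatrix_eq_zero_right {N : ℕ} {mu : YoungDiagram} (τ : Perm (Fin mu.card))
    (x : Fin N) {y : Fin N} (hy : ¬ (y : ℕ) < spechtDim mu) : spechtMatrix N mu τ x y = 0 := by
  simp [spechtMatrix, hy]

theorem trace_spechtMatrix {N : ℕ} {mu : YoungDiagram} (hN : spechtDim mu ≤ N)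
    (τ : Perm (Fin mu.card)) : (spechtMatrix N mu τ).trace = spechtChar mu τ := by
  rw [spechtChar, LinearMap.trace_eq_matrix_trace ℂ (spechtBasis mu)]
  refine (Fintype.sum_of_injective (Fin.castLE hN) (Fin.castLE_injective hN) _ _ ?_ ?_).symm
  · intro x hx
    exact spechtMatrix_eq_zero_left τ x fun h => hx ⟨⟨x, h⟩, rfl⟩
  · intro x
    rw [Matrix.diag_apply, Matrix.diag_apply, spechtMatrix_castLE, LinearMap.toMatrix_apply]

theorem spechtMatrix_mul {N : ℕ} {mu : YoungDiagram} (hN : spechtDim mu ≤ N)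
    (τ τ' : Perm (Fin mu.card)) :
    spechtMatrix N mu (τ * τ') = spechtMatrix N mu τ * spechtMatrix N mu τ' := by
  ext x y
  rw [Matrix.mul_apply]
  by_cases hx : (x : ℕ) < spechtDim mu
  swap
  · simp [spechtMatrix_eq_zero_left _ _ hx]
  by_cases hy : (y : ℕ) < spechtDim mu
  swap
  · simp [spechtMatrix_eq_zero_right _ _ hy]
  obtain ⟨x, rfl⟩ : ∃ x', x = Fin.castLE hN x' := ⟨⟨x, hx⟩, rfl⟩
  obtain ⟨y, rfl⟩ : ∃ y', y = Fin.castLE hN y' := ⟨⟨y, hy⟩, rfl⟩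
  rw [← Fintype.sum_of_injective (Fin.castLE hN) (Fin.castLE_injective hN)
    (fun z => (spechtBasis mu).repr (spechtRep mu τ (spechtBasis mu z)) x *
      (spechtBasis mu).repr (spechtRep mu τ' (spechtBasis mu y)) z)]
  · have h := LinearMap.toMatrix_mul (spechtBasis mu) (spechtRep mu τ) (spechtRep mu τ')
    have h1 := congrFun (congrFun h x) y
    rw [Matrix.mul_apply] at h1
    simp only [LinearMap.toMatrix_apply] at h1
    rw [spechtMatrix_castLE, map_mul, h1]
  · intro z hz
    rw [spechtMatrix_eq_zero_left _ _ fun h => hz ⟨⟨z, h⟩, rfl⟩, mul_zero]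
  · intro z
    rw [spechtMatrix_castLE, spechtMatrix_castLE]

theorem repr_spechtCast {N : ℕ} {mu nu : YoungDiagram} (h : mu = nu)
    (hN : spechtDim mu ≤ N) (hN' : spechtDim nu ≤ N)
    (τ : Perm (Fin mu.card)) (x : Fin (spechtDim nu)) (y : Fin (spechtDim mu)) :
    (spechtBasis nu).repr (LinearEquiv.cast (R := ℂ) (M := fun μ : YoungDiagram => Specht μ) h
      (spechtRep mu τ (spechtBasis mu y))) x
      = spechtMatrix N mu τ (Fin.castLE hN' x) (Fin.castLE hN y) := by
  subst h
  rw [spechtMatrix_castLE]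
  rfl

theorem spechtChar_conj (mu : YoungDiagram) (σ τ : Perm (Fin mu.card)) :
    spechtChar mu (σ * τ * σ⁻¹) = spechtChar mu τ := by
  unfold spechtChar
  rw [map_mul, LinearMap.trace_mul_comm, ← map_mul, ← mul_assoc, inv_mul_cancel, one_mul]

open Classical in
/-- The character of the Specht module of `mu` at a permutation of an arbitrary set; it is `0`
when the set does not have `|mu|` elements. -/
def charOn (mu : YoungDiagram) {T : Type*} (τ : Perm T) : ℂ :=
  if h : Nonempty (T ≃ Fin mu.card) then spechtChar mu (h.some.permCongr τ) else 0

theorem charOn_eq (mu : YoungDiagram) {T : Type*} (τ : Perm T) (e : T ≃ Fin mu.card) :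
    charOn mu τ = spechtChar mu (e.permCongr τ) := by
  have h : Nonempty (T ≃ Fin mu.card) := ⟨e⟩
  rw [charOn, dif_pos h, ← spechtChar_conj mu (h.some.symm.trans e)]
  congr 1
  ext x
  simp [Equiv.permCongr, Equiv.Perm.inv_def]

theorem charOn_ne_zero {mu : YoungDiagram} {T : Type*} {τ : Perm T} (h : charOn mu τ ≠ 0) :
    Nonempty (T ≃ Fin mu.card) := by
  by_contra h'
  exact h (dif_neg h')

instance : IsEmpty (Fin (⊥ : YoungDiagram).card) := by
  have : (⊥ : YoungDiagram).card = 0 := by simp [YoungDiagram.card]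
  rw [this]
  infer_instance

/-- Evaluation at the unique tabloid identifies the Specht module of the empty diagram with `ℂ`. -/
theorem charOn_bot_of_isEmpty {T : Type*} [IsEmpty T] (τ : Perm T) : charOn ⊥ τ = 1 := by
  rw [charOn_eq ⊥ τ (Equiv.equivOfIsEmpty _ _)]
  have h1 : (Equiv.equivOfIsEmpty T (Fin (⊥ : YoungDiagram).card)).permCongr τ = 1 :=
    Subsingleton.elim _ _
  let ev : Specht ⊥ →ₗ[ℂ] ℂ :=
    Finsupp.lapply (default : Fin (⊥ : YoungDiagram).card → ℕ) ∘ₗ (Specht ⊥).subtype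
  have hev : Function.Bijective ev := by
    constructor
    · intro v w hvw
      refine Subtype.ext (Finsupp.ext fun f => ?_)
      rw [Subsingleton.elim f default]
      exact hvw
    · have t : Tableau ⊥ := Classical.arbitrary _
      intro c
      refine ⟨c • ⟨polytabloid t, Submodule.subset_span ⟨t, rfl⟩⟩, ?_⟩
      have h := polytabloid_apply_tabloid t
      rw [Subsingleton.elim (tabloid t) default] at h
      rw [map_smul]
      change c • polytabloid t default = c
      rw [h, smul_eq_mul, mul_one]
  let B := (Module.Basis.singleton Unit ℂ).map (LinearEquiv.ofBijective ev hev).symm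
  rw [h1, spechtChar, map_one, LinearMap.trace_eq_matrix_trace ℂ B, LinearMap.toMatrix_one,
    Matrix.trace_one]
  simp

theorem charOn_bot_of_nonempty {T : Type*} [Nonempty T] (τ : Perm T) : charOn ⊥ τ = 0 := by
  by_contra h
  obtain ⟨e⟩ := charOn_ne_zero h
  exact isEmptyElim (e (Classical.arbitrary T))

end Character

/-! ### Sums over closed paths -/

section Paths

variable {κ : Type*} [Fintype κ] [DecidableEq κ]

/-- The arbitrary weight `g` on the two endpoints makes the induction run; taking for `g` one more
matrix closes the path up to a trace. -/
theorem sum_paths (q : ℕ) (M : Fin q → Matrix κ κ ℂ) (g : κ → κ → ℂ) :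
    ∑ p : Fin (q + 1) → κ, (∏ k : Fin q, M k (p k.castSucc) (p k.succ)) * g (p 0) (p (Fin.last q))
      = ∑ x, ∑ y, (List.ofFn M).prod x y * g x y := by
  induction q generalizing g with
  | zero =>
    rw [← (Equiv.funUnique (Fin 1) κ).symm.sum_comp]
    refine Finset.sum_congr rfl fun x _ => ?_
    rw [Finset.sum_eq_single x]
    · simp
    · intro y _ hy; simp [Matrix.one_apply_ne hy.symm]
    · simp
  | succ q ih =>
    rw [← (Fin.consEquiv fun _ => κ).sum_comp, Fintype.sum_prod_type_right]
    have h := ih (fun k => M k.succ) (fun x' y => ∑ x, M 0 x x' * g x y)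
    rw [List.ofFn_succ, List.prod_cons]
    refine (Finset.sum_congr rfl fun p _ => ?_).trans (h.trans ?_)
    · rw [Finset.mul_sum]
      refine Finset.sum_congr rfl fun x _ => ?_
      rw [Fin.prod_univ_succ]
      simp only [Fin.consEquiv_apply, Fin.castSucc_zero, Fin.cons_zero, Fin.cons_succ,
        ← Fin.succ_castSucc, ← Fin.succ_last]
      ring
    · simp only [Matrix.mul_apply, Finset.mul_sum, Finset.sum_mul]
      rw [Finset.sum_comm]
      rw [Finset.sum_congr rfl fun y _ => Finset.sum_comm]
      rw [Finset.sum_comm]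
      refine Finset.sum_congr rfl fun x _ => Finset.sum_congr rfl fun y _ =>
        Finset.sum_congr rfl fun x' _ => ?_
      ring

theorem sum_closed_paths (q : ℕ) [NeZero q] (M : Fin q → Matrix κ κ ℂ) :
    ∑ p : Fin q → κ, ∏ k : Fin q, M k (p k) (p (finRotate q k)) = (List.ofFn M).prod.trace := by
  obtain ⟨q, rfl⟩ := Nat.exists_eq_succ_of_ne_zero (NeZero.ne q)
  have h := sum_paths q (fun k => M k.castSucc) (fun x y => M (Fin.last q) y x)
  rw [List.ofFn_succ_last, List.prod_append, List.prod_singleton]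
  simp only [Matrix.trace, Matrix.diag_apply, Matrix.mul_apply]
  rw [← h]
  refine Finset.sum_congr rfl fun p _ => ?_
  rw [Fin.prod_univ_castSucc]
  simp

end Paths

/-! ### Residues modulo `q m` and the orbits of the shift by `m` -/

section Residues

variable {n : ℕ} [NeZero n]

/-- Division with remainder: `(i, k) ↦ i + k m` identifies `{0,…,m-1} × {0,…,q-1}` with the
residues modulo `q m`. -/
def residueEquiv (q m : ℕ) (h : n = q * m) : Fin m × Fin q ≃ ZMod n :=
  Equiv.ofBijective (fun x => ((x.1 + x.2 * m : ℕ) : ZMod n)) (by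
    have hlt : ∀ x : Fin m × Fin q, (x.1 + x.2 * m : ℕ) < n := fun x => by
      have h1 := x.1.2
      have h2 : ((x.2 : ℕ) + 1) * m ≤ q * m := Nat.mul_le_mul_right m x.2.2
      rw [h]
      linarith
    rw [Fintype.bijective_iff_injective_and_card]
    refine ⟨fun x y hxy => ?_, by simp [ZMod.card, h, mul_comm]⟩
    have h1 : (x.1 + x.2 * m : ℕ) = y.1 + y.2 * m := by
      have := congrArg ZMod.val hxy
      simpa only [ZMod.val_natCast_of_lt (hlt _)] using this
    have h2 : (x.1 : ℕ) = y.1 := by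
      have := congrArg (· % m) h1
      simpa [Nat.mod_eq_of_lt] using this
    have h3 : (x.2 : ℕ) = y.2 := by
      rw [h2] at h1
      exact Nat.eq_of_mul_eq_mul_right (Fin.pos x.1) (Nat.add_left_cancel h1)
    exact Prod.ext (Fin.ext h2) (Fin.ext h3))

theorem residueEquiv_apply (q m : ℕ) (h : n = q * m) (i : Fin m) (k : Fin q) :
    residueEquiv q m h (i, k) = ((i + k * m : ℕ) : ZMod n) := rfl

theorem natCast_mul_eq_mod (q m : ℕ) (h : n = q * m) (i k : ℕ) :
    ((i + k * m : ℕ) : ZMod n) = ((i + k % q * m : ℕ) : ZMod n) := by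
  rw [ZMod.natCast_eq_natCast_iff]
  refine Nat.ModEq.add_left i ?_
  rw [h]
  exact (Nat.mod_modEq k q).symm.mul_right' m

theorem residueEquiv_add (q m : ℕ) (h : n = q * m) (i : Fin m) (k : Fin q) :
    residueEquiv q m h (i, k) + (m : ZMod n) = residueEquiv q m h (i, finRotate q k) := by
  have hq : NeZero q := ⟨(Fin.pos k).ne'⟩
  have hk : ((finRotate q k : Fin q) : ℕ) = (k + 1) % q := by
    obtain ⟨q, rfl⟩ := Nat.exists_eq_succ_of_ne_zero (NeZero.ne q)
    simp [Fin.val_add]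
  rw [residueEquiv_apply, residueEquiv_apply, hk, ← natCast_mul_eq_mod q m h]
  push_cast
  ring

/-- The shift by `m` has `m` orbits of length `q` on the residues, and the sum factors into one sum
over closed paths for each orbit. -/
theorem sum_prod_shift {κ : Type*} [Fintype κ] [DecidableEq κ] (q m : ℕ) [NeZero q]
    (h : n = q * m) (c : ZMod n → Matrix κ κ ℂ) :
    ∑ p : ZMod n → κ, ∏ x, c x (p x) (p (x + m))
      = ∏ i : Fin m, (List.ofFn fun k => c (residueEquiv q m h (i, k))).prod.trace := by
  classical
  simp only [← sum_closed_paths]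
  rw [Finset.prod_univ_sum, Fintype.piFinset_univ]
  refine Fintype.sum_equiv (((residueEquiv q m h).symm.arrowCongr (Equiv.refl κ)).trans
    (Equiv.curry _ _ _)) _ _ fun p => ?_
  rw [← (residueEquiv q m h).prod_comp, Fintype.prod_prod_type]
  refine Finset.prod_congr rfl fun i _ => Finset.prod_congr rfl fun k _ => ?_
  rw [residueEquiv_add]
  rfl

end Residues

/-! ### The trace of a twisted group element -/

section Trace

variable {n : ℕ} [NeZero n] {r : ℕ} {lam : ZMod n → YoungDiagram}

instance : Finite (Splitting r lam) :=
  inferInstanceAs (Finite {f : Fin r → ZMod n //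
    ∀ i, (Finset.univ.filter fun x => f x = i).card = (lam i).card})

instance : Fintype (Splitting r lam) := Fintype.ofFinite _

/-- The permutation of `{1,…,c}` induced by `σ` between two `c`-element sets in increasing
enumeration. -/
def finsetRel (σ : Perm (Fin r)) {c : ℕ} (S T : Finset (Fin r)) (hS : S.card = c)
    (hT : T.card = c) (hST : ∀ x, x ∈ S ↔ σ x ∈ T) : Perm (Fin c) :=
  ((S.orderIsoOfFin hS).toEquiv.trans (σ.subtypeEquiv hST)).trans
    (T.orderIsoOfFin hT).toEquiv.symm

theorem spechtMatrix_finsetRel_congr (N : ℕ) (σ : Perm (Fin r)) {mu nu : YoungDiagram}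
    {S S' T T' : Finset (Fin r)} (hmu : mu = nu) (hSS : S = S') (hTT : T = T')
    (hS : S.card = mu.card) (hT : T.card = mu.card) (hST : ∀ x, x ∈ S ↔ σ x ∈ T)
    (hS' : S'.card = nu.card) (hT' : T'.card = nu.card) (hST' : ∀ x, x ∈ S' ↔ σ x ∈ T') :
    spechtMatrix N mu (finsetRel σ S T hS hT hST)
      = spechtMatrix N nu (finsetRel σ S' T' hS' hT' hST') := by
  subst hmu hSS hTT
  rfl

theorem spechtMatrix_rel_congr (N : ℕ) (σ : Perm (Fin r)) (X Y : Splitting r lam)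
    {i j : ZMod n} (hij : lam i = lam j) (h : ∀ x, X.1 x = i ↔ Y.1 x = j) :
    spechtMatrix N (lam i) (X.rel σ i) = spechtMatrix N (lam j) (Y.rel σ j) := by
  refine spechtMatrix_finsetRel_congr N σ (S := X.block i) (S' := Y.block j)
    (T := (X.perm σ).block i) (T' := (Y.perm σ).block j) hij ?_ ?_ (X.2 i) ((X.perm σ).2 i)
    (X.mem_block_perm σ i) (Y.2 j) ((Y.perm σ).2 j) (Y.mem_block_perm σ j)
  · ext x
    rw [X.mem_block, Y.mem_block, h]
  · ext x
    rw [(X.perm σ).mem_block, (Y.perm σ).mem_block]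
    exact h _

/-- Iteration of the cocycle identity `Splitting.rel_mul`; the leftmost factor acts last, hence the
exponents `q - 1 - k`. -/
theorem rel_pow_prod {N : ℕ} (X : Splitting r lam) (σ : Perm (Fin r)) (i : ZMod n)
    (hN : spechtDim (lam i) ≤ N) (q : ℕ) [NeZero q] :
    (List.ofFn fun k : Fin q =>
        spechtMatrix N (lam i) ((X.perm (σ ^ (q - 1 - k))).rel σ i)).prod
      = spechtMatrix N (lam i) (X.rel (σ ^ q) i) := by
  obtain ⟨q, rfl⟩ := Nat.exists_eq_succ_of_ne_zero (NeZero.ne q)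
  induction q with
  | zero => simp [Splitting.perm_one]
  | succ q ih =>
    rw [List.ofFn_succ, List.prod_cons, pow_succ' σ (q + 1), Splitting.rel_mul,
      spechtMatrix_mul hN, ← ih]
    congr 4
    ext1 k
    have : q + 1 + 1 - 1 - ((k.succ : Fin _) : ℕ) = q + 1 - 1 - k := by
      rw [Fin.val_succ]
      omega
    rw [this]

/-- The splittings fixed by `σ` followed by the shift. -/
def Splitting.IsFixed (X : Splitting r lam) (σ : Perm (Fin r)) (a : ZMod n) : Prop :=
  ∀ x, X.1 (σ x) = X.1 x - a

theorem lam_add_natCast_mul {a : ZMod n} (h : ∀ i, lam (i + a) = lam i) (k : ℕ) (i : ZMod n) :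
    lam (i + k * a) = lam i := by
  induction k generalizing i with
  | zero => simp
  | succ k ih => rw [Nat.cast_add, Nat.cast_one, add_mul, one_mul, ← add_assoc, h, ih]

theorem Splitting.IsFixed.perm_pow {X : Splitting r lam} {σ : Perm (Fin r)} {a : ZMod n}
    (hX : X.IsFixed σ a) (k : ℕ) (x : Fin r) : (X.perm (σ ^ k)).1 x = X.1 x + k * a := by
  have h : ∀ x, X.1 ((σ ^ k) x) = X.1 x - k * a := by
    induction k with
    | zero => simp
    | succ k ih =>
      intro x
      rw [pow_succ', Equiv.Perm.mul_apply, hX, ih]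
      push_cast
      ring
  have h1 := h ((σ ^ k).symm x)
  rw [Equiv.apply_symm_apply] at h1
  change X.1 ((σ ^ k).symm x) = _
  rw [h1]
  ring

/-- Each orbit of tensor factors under the shift contributes the trace of the product of the
operators met along it, and for a fixed `X` these are the successive steps of `σ ^ q` on one block.
-/
theorem trace_rotate_map (q m : ℕ) [NeZero q] (hn : n = q * m)
    (h : ∀ i, lam (i + (m : ZMod n)) = lam i) (X : Splitting r lam) (σ : Perm (Fin r))
    (hX : X.IsFixed σ m) :
    ∑ p, (tensorBasis lam).repr (rotate (m : ZMod n) h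
        (PiTensorProduct.map (fun i => spechtRep (lam i) (X.rel σ i)) (tensorBasis lam p))) p
      = ∏ i : Fin m, spechtChar (lam ((i : ℕ) : ZMod n)) (X.rel (σ ^ q) ((i : ℕ) : ZMod n)) := by
  classical
  -- A common size, so that the dependent families of basis indices extend to functions into `Fin
  -- N`; the added terms are zero.
  let N := ∑ i, spechtDim (lam i)
  have hN : ∀ i, spechtDim (lam i) ≤ N := fun i =>
    Finset.single_le_sum (f := fun i => spechtDim (lam i)) (fun _ _ => Nat.zero_le _)
      (Finset.mem_univ i)
  let c : ZMod n → Matrix (Fin N) (Fin N) ℂ := fun x =>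
    spechtMatrix N (lam (x + m)) (X.rel σ (x + m))
  have h1 : ∀ p, (tensorBasis lam).repr (rotate (m : ZMod n) h
      (PiTensorProduct.map (fun i => spechtRep (lam i) (X.rel σ i)) (tensorBasis lam p))) p
      = ∏ x, c x (Fin.castLE (hN x) (p x)) (Fin.castLE (hN (x + m)) (p (x + m))) := by
    intro p
    unfold tensorBasis
    rw [Basis.piTensorProduct_apply, PiTensorProduct.map_tprod, rotate_tprod,
      Basis.piTensorProduct_repr_tprod_apply]
    refine Finset.prod_congr rfl fun x _ => ?_
    exact repr_spechtCast (h x) (hN (x + m)) (hN x) (X.rel σ (x + m)) (p x) (p (x + m))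
  simp only [h1]
  have hinj : Function.Injective fun (p : ∀ i, Fin (spechtDim (lam i))) (i : ZMod n) =>
      Fin.castLE (hN i) (p i) := fun p p' hpp => funext fun i =>
    Fin.castLE_injective (hN i) (congrFun hpp i)
  rw [Fintype.sum_of_injective _ hinj _
    (fun p : ZMod n → Fin N => ∏ x, c x (p x) (p (x + m))) _ fun p => rfl]
  · rw [sum_prod_shift q m hn]
    refine Finset.prod_congr rfl fun i _ => ?_
    rw [← trace_spechtMatrix (hN _), ← rel_pow_prod X σ _ (hN _) q]
    congr 3
    ext1 k
    have hk : residueEquiv q m hn (i, k) + (m : ZMod n)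
        = ((i : ℕ) : ZMod n) + ((k + 1 : ℕ) : ZMod n) * m := by
      rw [residueEquiv_apply]
      push_cast
      ring
    refine spechtMatrix_rel_congr N σ _ _ ?_ ?_
    · rw [hk, lam_add_natCast_mul h]
    · intro x
      rw [hX.perm_pow, hk]
      -- The block `i + (k + 1) m` of `X` is the block `i` of `σ ^ (q - 1 - k) X`, because `q m = 0`
      -- modulo `n`.
      have hz : ((k + 1 : ℕ) : ZMod n) * m = -(((q - 1 - k : ℕ) : ZMod n) * m) := by
        rw [eq_neg_iff_add_eq_zero, ← add_mul, ← Nat.cast_add,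
          show ((k : ℕ) + 1 + (q - 1 - k)) = q by have := k.2; omega, ← Nat.cast_mul, ← hn,
          ZMod.natCast_self]
      rw [hz, ← sub_eq_add_neg, eq_sub_iff_add_eq]
  · intro p hp
    have hp' : ∃ x, ¬ (p x : ℕ) < spechtDim (lam x) := by
      by_contra! hp'
      exact hp ⟨fun x => ⟨p x, hp' x⟩, rfl⟩
    obtain ⟨x, hx⟩ := hp'
    refine Finset.prod_eq_zero (Finset.mem_univ x) (spechtMatrix_eq_zero_left _ _ ?_)
    rwa [h]

-- The operator permutes the summands `t_X ⊗ V`, so only the summands that it preserves contribute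
-- to the trace.
open Classical in
theorem trace_intertwiner_comp_rho (q m : ℕ) [NeZero q] (hn : n = q * m)
    (h : ∀ i, lam (i + (m : ZMod n)) = lam i) (g : G n r) :
    LinearMap.trace ℂ (W lam r) (intertwiner lam r (m : ZMod n) ∘ₗ rho lam r g)
      = ∑ X : Splitting r lam, if X.IsFixed g.right m then
          (X.perm g.right).weight g.left * ∏ i : Fin m,
            spechtChar (lam ((i : ℕ) : ZMod n)) (X.rel (g.right ^ q) ((i : ℕ) : ZMod n))
        else 0 := by
  let B : Module.Basis (Σ _ : Splitting r lam, ∀ i, Fin (spechtDim (lam i))) ℂ (W lam r) :=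
    Finsupp.basis fun _ => tensorBasis lam
  rw [LinearMap.trace_eq_matrix_trace ℂ B]
  have hfix : ∀ X : Splitting r lam,
      (X.perm g.right).shift (m : ZMod n) h = X ↔ X.IsFixed g.right m := by
    intro X
    constructor
    · intro hX x
      have h1 := congrFun (congrArg Subtype.val hX) (g.right x)
      change X.1 (g.right.symm (g.right x)) - m = X.1 (g.right x) at h1
      rw [← h1, Equiv.symm_apply_apply]
    · intro hX
      refine Splitting.ext fun x => ?_
      change X.1 (g.right.symm x) - m = X.1 x
      rw [← hX, Equiv.apply_symm_apply]
  rw [Matrix.trace, Fintype.sum_sigma]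
  refine Finset.sum_congr rfl fun X _ => ?_
  have hd : ∀ p, (LinearMap.toMatrix B B (intertwiner lam r (m : ZMod n) ∘ₗ rho lam r g)).diag
      ⟨X, p⟩ = if X.IsFixed g.right m then (X.perm g.right).weight g.left *
        (tensorBasis lam).repr (rotate (m : ZMod n) h (PiTensorProduct.map
          (fun i => spechtRep (lam i) (X.rel g.right i)) (tensorBasis lam p))) p else 0 := by
    intro p
    rw [Matrix.diag_apply, LinearMap.toMatrix_apply, LinearMap.comp_apply]
    have hB : B ⟨X, p⟩ = Finsupp.single X (tensorBasis lam p) := by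
      simp [B]
    rw [hB, rho_single, map_smul, intertwiner_single _ h]
    have hr : ∀ w : W lam r, B.repr w ⟨X, p⟩ = (tensorBasis lam).repr (w X) p := fun w => rfl
    rw [hr, Finsupp.smul_apply, map_smul, Finsupp.smul_apply, smul_eq_mul]
    by_cases hX : X.IsFixed g.right m
    · rw [if_pos hX, (hfix X).2 hX, Finsupp.single_eq_same]
    · rw [if_neg hX, Finsupp.single_eq_of_ne fun h' => hX ((hfix X).1 h'.symm)]
      simp
  simp only [hd]
  by_cases hX : X.IsFixed g.right m
  · simp only [if_pos hX]
    rw [← Finset.mul_sum, trace_rotate_map q m hn h X g.right hX]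
  · simp [hX]

end Trace

/-! ### Summation over residues along the cycles -/

section CycleSum

theorem finRotate_val {l : ℕ} (k : Fin l) : ((finRotate l k : Fin l) : ℕ) = (k + 1) % l := by
  obtain ⟨l, rfl⟩ := Nat.exists_eq_succ_of_ne_zero (Fin.pos k).ne'
  simp [Fin.val_add]

/-- A product of disjoint cycles, of lengths `len j` for the `j` with `psi j = i`. -/
def cycleModel {s : ℕ} (len psi : Fin s → ℕ) (i : ℕ) :
    Perm (Σ j : {j // psi j = i}, Fin (len j)) :=
  Equiv.sigmaCongrRight fun j => finRotate (len j)

variable {n : ℕ} [NeZero n] {r s : ℕ} {lam : ZMod n → YoungDiagram} {len : Fin s → ℕ}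
  {σ : Perm (Fin r)} {c : (Σ j : Fin s, Fin (len j)) ≃ Fin r}

theorem pow_apply_cycle (hc : ∀ j k, σ (c ⟨j, k⟩) = c ⟨j, finRotate (len j) k⟩) (t : ℕ)
    (j : Fin s) (k : Fin (len j)) :
    (σ ^ t) (c ⟨j, k⟩) = c ⟨j, ⟨(k + t) % len j, Nat.mod_lt _ (Fin.pos k)⟩⟩ := by
  induction t with
  | zero => simp [Nat.mod_eq_of_lt k.2]
  | succ t ih =>
    rw [pow_succ', Equiv.Perm.mul_apply, ih, hc]
    congr 2
    apply Fin.ext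
    rw [finRotate_val]
    simp [add_assoc]

theorem apply_pow_of_shift {a : ZMod n} {f : Fin r → ZMod n} (hf : ∀ x, f (σ x) = f x - a)
    (t : ℕ) (x : Fin r) : f ((σ ^ t) x) = f x - t * a := by
  induction t with
  | zero => simp
  | succ t ih =>
    rw [pow_succ', Equiv.Perm.mul_apply, hf, ih]
    push_cast
    ring

/-- One full turn of the cycle subtracts `len j * m`, which must vanish modulo `q m`. -/
theorem dvd_len_of_shift {q m : ℕ} (hn : n = q * m) {f : Fin r → ZMod n}
    (hf : ∀ x, f (σ x) = f x - m)
    (hc : ∀ j k, σ (c ⟨j, k⟩) = c ⟨j, finRotate (len j) k⟩) {j : Fin s} (hj : 0 < len j) :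
    q ∣ len j := by
  have h := apply_pow_of_shift hf (len j) (c ⟨j, ⟨0, hj⟩⟩)
  rw [pow_apply_cycle hc] at h
  simp only [zero_add, Nat.mod_self] at h
  have h1 : ((len j * m : ℕ) : ZMod n) = 0 := by
    push_cast
    linear_combination h
  rw [ZMod.natCast_eq_zero_iff, hn] at h1
  have hm : 0 < m := Nat.pos_of_ne_zero fun hm => NeZero.ne n (by rw [hn, hm, mul_zero])
  exact Nat.dvd_of_mul_dvd_mul_right hm h1

/-- The function that takes prescribed values at the first letters of the cycles and decreases
by `m` along each cycle. -/
def cycleFill {q m : ℕ} (hn : n = q * m) (c : (Σ j : Fin s, Fin (len j)) ≃ Fin r)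
    (phi : Fin s → Fin m × Fin q) (x : Fin r) : ZMod n :=
  residueEquiv q m hn (phi (c.symm x).1) - ((c.symm x).2 : ℕ) * m

variable {q m : ℕ} (hn : n = q * m)

theorem cycleFill_apply (phi : Fin s → Fin m × Fin q) (j : Fin s) (k : Fin (len j)) :
    cycleFill hn c phi (c ⟨j, k⟩) = residueEquiv q m hn (phi j) - (k : ℕ) * m := by
  unfold cycleFill
  rw [c.symm_apply_apply]

theorem cast_mod_mul (hn : n = q * m) {l : ℕ} (hl : q ∣ l) (k : ℕ) :
    ((k % l : ℕ) : ZMod n) * m = k * m := by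
  rw [← Nat.cast_mul, ← Nat.cast_mul, ZMod.natCast_eq_natCast_iff, hn]
  exact ((Nat.mod_modEq k l).of_dvd hl).mul_right' m

theorem cycleFill_shift (hc : ∀ j k, σ (c ⟨j, k⟩) = c ⟨j, finRotate (len j) k⟩)
    (hq : ∀ j, q ∣ len j) (phi : Fin s → Fin m × Fin q) (x : Fin r) :
    cycleFill hn c phi (σ x) = cycleFill hn c phi x - m := by
  obtain ⟨⟨j, k⟩, rfl⟩ := c.surjective x
  rw [hc, cycleFill_apply, cycleFill_apply, finRotate_val, cast_mod_mul hn (hq j)]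
  push_cast
  ring

theorem cycleFill_of_shift (hc : ∀ j k, σ (c ⟨j, k⟩) = c ⟨j, finRotate (len j) k⟩)
    (hpos : ∀ j, 0 < len j) {f : Fin r → ZMod n} (hf : ∀ x, f (σ x) = f x - m) :
    cycleFill hn c (fun j => (residueEquiv q m hn).symm (f (c ⟨j, ⟨0, hpos j⟩⟩))) = f := by
  ext1 x
  obtain ⟨⟨j, k⟩, rfl⟩ := c.surjective x
  rw [cycleFill_apply, Equiv.apply_symm_apply]
  have h := apply_pow_of_shift hf k (c ⟨j, ⟨0, hpos j⟩⟩)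
  rw [← h, pow_apply_cycle hc]
  congr 3
  apply Fin.ext
  simp [Nat.mod_eq_of_lt k.2]

theorem add_mul_lt {l l' : ℕ} (h : l = q * l') (x : Fin q) (k : Fin l') :
    (x + q * k : ℕ) < l := by
  have h1 : q * ((k : ℕ) + 1) ≤ q * l' := Nat.mul_le_mul_left q k.2
  have h2 := x.2
  rw [h]
  linarith

theorem residueEquiv_sub (hn : n = q * m) (x : Fin m × Fin q) (k : ℕ) :
    residueEquiv q m hn x - ((x.2 + q * k : ℕ) : ZMod n) * m = ((x.1 : ℕ) : ZMod n) := by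
  have h0 : (q : ZMod n) * m = 0 := by rw [← Nat.cast_mul, ← hn, ZMod.natCast_self]
  obtain ⟨i, y⟩ := x
  rw [residueEquiv_apply]
  push_cast
  linear_combination -(k : ZMod n) * h0

variable {len' : Fin s → ℕ}

/-- The letters of the cycles of class `i`, as a map to all letters. -/
def fiberMap (hlen : ∀ j, len j = q * len' j) (c : (Σ j : Fin s, Fin (len j)) ≃ Fin r)
    (phi : Fin s → Fin m × Fin q) (i : ℕ)
    (x : Σ j : {j // ((phi j).1 : ℕ) = i}, Fin (len' j)) : Fin r :=
  c ⟨x.1, ⟨(phi x.1).2 + q * x.2, add_mul_lt (hlen _) _ _⟩⟩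

/-- With `phi j = (i, y)`, position `k` has colour `i + (y - k) m`, which equals `i` exactly when `k
≡ y` modulo `q`; hence the positions `y + q t`. -/
theorem cycleFill_fiberMap (hlen : ∀ j, len j = q * len' j)
    (phi : Fin s → Fin m × Fin q) (i : ℕ)
    (x : Σ j : {j // ((phi j).1 : ℕ) = i}, Fin (len' j)) :
    cycleFill hn c phi (fiberMap hlen c phi i x) = (i : ZMod n) := by
  rw [fiberMap, cycleFill_apply, residueEquiv_sub, x.1.2]

theorem fiberMap_injective (hq : 0 < q) (hlen : ∀ j, len j = q * len' j)
    (phi : Fin s → Fin m × Fin q) (i : ℕ) : Function.Injective (fiberMap hlen c phi i) := by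
  rintro ⟨⟨j, hj⟩, k⟩ ⟨⟨j', hj'⟩, k'⟩ h
  have h1 := c.injective h
  simp only [Sigma.mk.injEq] at h1
  obtain ⟨rfl, h2⟩ := h1
  have h3 := congrArg Fin.val (eq_of_heq h2)
  have h4 : k = k' := Fin.ext (Nat.eq_of_mul_eq_mul_left hq (Nat.add_left_cancel h3))
  rw [h4]

theorem exists_fiberMap_eq (hlen : ∀ j, len j = q * len' j)
    (phi : Fin s → Fin m × Fin q) {i : ℕ} (hi : i < m) {x : Fin r}
    (hx : cycleFill hn c phi x = (i : ZMod n)) : ∃ y, fiberMap hlen c phi i y = x := by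
  obtain ⟨⟨j, k⟩, rfl⟩ := c.surjective x
  have hk : (k : ℕ) < q * len' j := k.2.trans_eq (hlen j)
  have hq : 0 < q := Nat.pos_of_ne_zero fun h => by
    rw [h, zero_mul] at hk
    omega
  rw [cycleFill_apply, sub_eq_iff_eq_add] at hx
  have h1 : residueEquiv q m hn (phi j)
      = residueEquiv q m hn (⟨i, hi⟩, ⟨k % q, Nat.mod_lt _ hq⟩) := by
    rw [hx, residueEquiv_apply, ← natCast_mul_eq_mod q m hn]
    push_cast
    rfl
  have h2 := (residueEquiv q m hn).injective h1
  refine ⟨⟨⟨j, by rw [h2]⟩, ⟨k / q, ?_⟩⟩, ?_⟩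
  · rw [Nat.div_lt_iff_lt_mul hq, mul_comm]
    exact hk
  · unfold fiberMap
    congr 2
    apply Fin.ext
    simp only [h2]
    exact Nat.mod_add_div k q

/-- The letters at which `cycleFill` takes the value `i`. -/
def fiberEquiv (hq : 0 < q) (hlen : ∀ j, len j = q * len' j)
    (c : (Σ j : Fin s, Fin (len j)) ≃ Fin r) (phi : Fin s → Fin m × Fin q) {i : ℕ} (hi : i < m) :
    (Σ j : {j // ((phi j).1 : ℕ) = i}, Fin (len' j)) ≃
      {x // cycleFill hn c phi x = (i : ZMod n)} :=
  Equiv.ofBijective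
    (fun x => ⟨fiberMap hlen c phi i x, cycleFill_fiberMap hn hlen phi i x⟩)
    ⟨fun _ _ h => fiberMap_injective hq hlen phi i (congrArg Subtype.val h), fun x => by
      obtain ⟨y, hy⟩ := exists_fiberMap_eq hn hlen phi hi x.2
      exact ⟨y, Subtype.ext hy⟩⟩

/-- Applying `σ ^ q` moves the position `y + q t` to `y + q (t + 1)` modulo `q * len' j`, so `t`
rotates modulo `len' j`. -/
theorem pow_fiberMap (hc : ∀ j k, σ (c ⟨j, k⟩) = c ⟨j, finRotate (len j) k⟩)
    (hlen : ∀ j, len j = q * len' j) (phi : Fin s → Fin m × Fin q) (i : ℕ)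
    (x : Σ j : {j // ((phi j).1 : ℕ) = i}, Fin (len' j)) :
    (σ ^ q) (fiberMap hlen c phi i x)
      = fiberMap hlen c phi i (cycleModel len' (fun j => (phi j).1) i x) := by
  obtain ⟨⟨j, hj⟩, k⟩ := x
  unfold fiberMap
  rw [pow_apply_cycle hc]
  refine congrArg c (congrArg (Sigma.mk j) (Fin.ext ?_))
  have h2 := (phi j).2.2
  change ((phi j).2 + q * k + q : ℕ) % len j
    = (phi j).2 + q * ((finRotate (len' j) k : Fin (len' j)) : ℕ)
  rw [finRotate_val, hlen, show ((phi j).2 : ℕ) + q * k + q = (phi j).2 + q * (k + 1) by ring,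
    Nat.mod_mul, Nat.add_mul_mod_self_left, Nat.mod_eq_of_lt h2,
    Nat.add_mul_div_left _ _ (by omega), Nat.div_eq_of_lt h2, zero_add]

theorem spechtChar_rel_pow [NeZero q]
    (hc : ∀ j k, σ (c ⟨j, k⟩) = c ⟨j, finRotate (len j) k⟩)
    (hlen : ∀ j, len j = q * len' j) (phi : Fin s → Fin m × Fin q) (X : Splitting r lam)
    (hX : X.1 = cycleFill hn c phi) {i : ℕ} (hi : i < m) :
    spechtChar (lam (i : ZMod n)) (X.rel (σ ^ q) (i : ZMod n))
      = charOn (lam (i : ZMod n)) (cycleModel len' (fun j => (phi j).1) i) := by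
  have hq : 0 < q := Nat.pos_of_ne_zero (NeZero.ne q)
  have hfix : X.IsFixed σ m := fun x => by
    rw [hX]
    exact cycleFill_shift hn hc (fun j => ⟨_, hlen j⟩) phi x
  have hperm : X.perm (σ ^ q) = X := by
    refine Splitting.ext fun x => ?_
    rw [hfix.perm_pow, ← Nat.cast_mul, ← hn, ZMod.natCast_self, add_zero]
  let E := ((fiberEquiv hn hq hlen c phi hi).trans (Equiv.subtypeEquivRight fun x => by
    rw [X.mem_block, hX])).trans (X.enum (i : ZMod n)).symm
  have hE : ∀ x, (X.enum (i : ZMod n) (E x) : Fin r) = fiberMap hlen c phi i x := by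
    intro x
    simp only [E, Equiv.trans_apply, Equiv.apply_symm_apply]
    rfl
  rw [charOn_eq _ _ E]
  congr 1
  ext1 j
  obtain ⟨x, rfl⟩ := E.surjective j
  apply (X.enum (i : ZMod n)).injective
  apply Subtype.ext
  rw [X.enum_rel_of_perm_eq hperm, hE, pow_fiberMap hc]
  simp [hE]

theorem card_filter_eq_of_shift {f : Fin r → ZMod n} {a : ZMod n}
    (hf : ∀ x, f (σ x) = f x - a) (i : ZMod n) :
    (Finset.univ.filter fun x => f x = i + a).card
      = (Finset.univ.filter fun x => f x = i).card := by
  refine Finset.card_bij (fun x _ => σ x) ?_ ?_ ?_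
  · intro x hx
    simp only [Finset.mem_filter, Finset.mem_univ, true_and] at hx ⊢
    rw [hf, hx, add_sub_cancel_right]
  · intro _ _ _ _ h
    exact σ.injective h
  · intro y hy
    simp only [Finset.mem_filter, Finset.mem_univ, true_and] at hy
    refine ⟨σ.symm y, ?_, by simp⟩
    have h := hf (σ.symm y)
    rw [Equiv.apply_symm_apply, hy] at h
    simp [h]

/-- A nonzero `charOn` forces the right cardinality for the blocks `i < m`; `σ` carries this to the
other blocks, since `lam` is periodic. -/
theorem exists_splitting_of_cycleFill [NeZero q] (h : ∀ i, lam (i + (m : ZMod n)) = lam i)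
    (hc : ∀ j k, σ (c ⟨j, k⟩) = c ⟨j, finRotate (len j) k⟩)
    (hlen : ∀ j, len j = q * len' j) (phi : Fin s → Fin m × Fin q)
    (hphi : ∀ i : Fin m, charOn (lam ((i : ℕ) : ZMod n))
      (cycleModel len' (fun j => (phi j).1) i) ≠ 0) :
    ∃ X : Splitting r lam, X.1 = cycleFill hn c phi := by
  have hq : 0 < q := Nat.pos_of_ne_zero (NeZero.ne q)
  have h0 : ∀ (i : Fin m) (k : ℕ),
      (Finset.univ.filter fun x => cycleFill hn c phi x = ((i : ℕ) : ZMod n) + k * m).card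
        = (lam (((i : ℕ) : ZMod n) + k * m)).card := by
    intro i k
    induction k with
    | zero =>
      obtain ⟨e⟩ := charOn_ne_zero (hphi i)
      have h1 := Fintype.card_congr ((fiberEquiv hn hq hlen c phi i.2).symm.trans e)
      rw [Fintype.card_subtype, Fintype.card_fin] at h1
      simpa using h1
    | succ k ih =>
      rw [show ((i : ℕ) : ZMod n) + (k + 1 : ℕ) * m = ((i : ℕ) : ZMod n) + k * m + m by
          push_cast; ring,
        h, ← ih]
      exact card_filter_eq_of_shift
        (cycleFill_shift hn hc (fun j => ⟨_, hlen j⟩) phi) _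
  refine ⟨⟨cycleFill hn c phi, fun i => ?_⟩, rfl⟩
  obtain ⟨⟨i, k⟩, rfl⟩ := (residueEquiv q m hn).surjective i
  have h1 := h0 i k
  rw [residueEquiv_apply]
  push_cast
  convert h1

/-- A fixed splitting is determined by the colours of the first letters, so the sum can run over all
choices `phi` of these colours. -/
theorem trace_eq_sum_cycles [NeZero q] (h : ∀ i, lam (i + (m : ZMod n)) = lam i) (g : G n r)
    (hc : ∀ j k, g.right (c ⟨j, k⟩) = c ⟨j, finRotate (len j) k⟩)
    (hlen : ∀ j, len j = q * len' j) (hpos : ∀ j, 0 < len j) :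
    LinearMap.trace ℂ (W lam r) (intertwiner lam r (m : ZMod n) ∘ₗ rho lam r g)
      = ∑ phi : Fin s → Fin m × Fin q,
          (∏ x, ((g.left x : ℂˣ) : ℂ) ^ (cycleFill hn c phi x + m).val) *
            ∏ i : Fin m, charOn (lam ((i : ℕ) : ZMod n))
              (cycleModel len' (fun j => (phi j).1) i) := by
  classical
  rw [trace_intertwiner_comp_rho q m hn h, ← Finset.sum_filter]
  refine Finset.sum_of_injOn
    (fun X j => (residueEquiv q m hn).symm (X.1 (c ⟨j, ⟨0, hpos j⟩⟩))) ?_ ?_ ?_ ?_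
  · intro X hX Y hY hXY
    have hX' : X.IsFixed g.right m := by simpa using hX
    have hY' : Y.IsFixed g.right m := by simpa using hY
    have h1 := cycleFill_of_shift hn hc hpos hX'
    have h2 := cycleFill_of_shift hn hc hpos hY'
    apply Subtype.ext
    rw [← h1, ← h2]
    exact congrArg (cycleFill hn c) hXY
  · intro X _
    simp
  -- A colouring whose blocks have the wrong sizes contributes `0`, by the default value of
  -- `charOn`.
  · intro phi _ hphi
    by_contra hne
    have hne' := Finset.prod_ne_zero_iff.1 (right_ne_zero_of_mul hne)
    obtain ⟨X, hX⟩ := exists_splitting_of_cycleFill hn h hc hlen phi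
      fun i => hne' i (Finset.mem_univ i)
    refine hphi ⟨X, ?_, ?_⟩
    · rw [Finset.mem_coe, Finset.mem_filter]
      refine ⟨Finset.mem_univ _, fun x => ?_⟩
      rw [hX]
      exact cycleFill_shift hn hc (fun j => ⟨_, hlen j⟩) phi x
    · ext1 j
      simp only [hX, cycleFill_apply]
      simp
  · intro X hX
    have hX' : X.IsFixed g.right m := by simpa using hX
    have h1 := cycleFill_of_shift hn hc hpos hX'
    rw [h1]
    congr 1
    · unfold Splitting.weight
      refine Finset.prod_congr rfl fun x _ => ?_
      -- The weight is that of `σ X`, whose colours exceed those of `X` by `m`.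
      have h2 := hX'.perm_pow 1 x
      rw [pow_one, Nat.cast_one, one_mul] at h2
      rw [h2]
    · exact Finset.prod_congr rfl fun i _ => spechtChar_rel_pow hn hc hlen _ X h1.symm i.2

/-- The sum over all ways of distributing the cycles, of lengths `len j` and with cycle products
`xi j`, over `m` blocks. -/
def cycleSum (lam : ZMod n → YoungDiagram) (m : ℕ) (len : Fin s → ℕ)
    (xi : Fin s → rootsOfUnity n ℂ) : ℂ :=
  ∑ psi : Fin s → Fin m, (∏ j, ((xi j : ℂˣ) : ℂ) ^ (psi j : ℕ)) *
    ∏ i : Fin m, charOn (lam ((i : ℕ) : ZMod n)) (cycleModel len (fun j => psi j) i)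

theorem rootsOfUnity_pow_val (ξ : rootsOfUnity n ℂ) (k : ℕ) :
    ((ξ : ℂˣ) : ℂ) ^ ((k : ZMod n)).val = ((ξ : ℂˣ) : ℂ) ^ k := by
  have h : ((ξ : ℂˣ) : ℂ) ^ n = 1 := by
    rw [← Units.val_pow_eq_pow_val, (mem_rootsOfUnity _ _).1 ξ.2, Units.val_one]
  rw [ZMod.val_natCast, ← pow_eq_pow_mod k h]

/-- Only the first letter of each cycle carries weight, namely `xi j ^ (i + (k + 1) m)`, while the
characters ignore `k`; so the sums over the `k` split off. -/
theorem trace_eq_mul_cycleSum [NeZero q] (hn : n = q * m) (h : ∀ i, lam (i + (m : ZMod n)) = lam i) (g : G n r)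
    (hc : ∀ j k, g.right (c ⟨j, k⟩) = c ⟨j, finRotate (len j) k⟩)
    (hlen : ∀ j, len j = q * len' j) (hpos : ∀ j, 0 < len j) (xi : Fin s → rootsOfUnity n ℂ)
    (hg : ∀ j k, g.left (c ⟨j, k⟩) = if (k : ℕ) = 0 then xi j else 1) :
    LinearMap.trace ℂ (W lam r) (intertwiner lam r (m : ZMod n) ∘ₗ rho lam r g)
      = (∏ j, ∑ k : Fin q, (((xi j : ℂˣ) : ℂ) ^ m) ^ ((k : ℕ) + 1)) * cycleSum lam m len' xi := by
  rw [trace_eq_sum_cycles hn h g hc hlen hpos]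
  have hw : ∀ phi : Fin s → Fin m × Fin q,
      ∏ x, ((g.left x : ℂˣ) : ℂ) ^ (cycleFill hn c phi x + m).val
        = (∏ j, (((xi j : ℂˣ) : ℂ) ^ m) ^ (((phi j).2 : ℕ) + 1)) *
          ∏ j, ((xi j : ℂˣ) : ℂ) ^ ((phi j).1 : ℕ) := by
    intro phi
    rw [← c.prod_comp, Fintype.prod_sigma, ← Finset.prod_mul_distrib]
    refine Finset.prod_congr rfl fun j _ => ?_
    rw [Finset.prod_eq_single ⟨0, hpos j⟩]
    · rw [hg, if_pos rfl, cycleFill_apply]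
      have : residueEquiv q m hn (phi j) - ((0 : ℕ) : ZMod n) * m + m
          = (((phi j).1 + (phi j).2 * m + m : ℕ) : ZMod n) := by
        rw [show phi j = ((phi j).1, (phi j).2) from rfl, residueEquiv_apply]
        push_cast
        ring
      rw [this, rootsOfUnity_pow_val]
      ring
    · intro k _ hk
      rw [hg, if_neg fun hk' => hk (Fin.ext hk')]
      simp
    · simp
  simp only [hw]
  rw [Finset.prod_univ_sum, Fintype.piFinset_univ, cycleSum, Finset.sum_mul_sum,
    Finset.sum_comm, ← Fintype.sum_prod_type']
  refine Fintype.sum_equiv (Equiv.arrowProdEquivProdArrow (Fin s) (fun _ => Fin m) fun _ => Fin q)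
    _ _ fun phi => ?_
  rw [mul_assoc]
  rfl

theorem chi_truncate_eq_cycleSum (hm : m ≤ n) (g : G n r)
    (hc : ∀ j k, g.right (c ⟨j, k⟩) = c ⟨j, finRotate (len j) k⟩)
    (hpos : ∀ j, 0 < len j) (xi : Fin s → rootsOfUnity n ℂ)
    (hg : ∀ j, ∏ k, g.left (c ⟨j, k⟩) = xi j) :
    chi (truncate m lam) r g = cycleSum lam m len xi := by
  have hn1 : n = 1 * n := (one_mul n).symm
  have h0 : chi (truncate m lam) r g = LinearMap.trace ℂ (W (truncate m lam) r)
      (intertwiner (truncate m lam) r (n : ZMod n) ∘ₗ rho (truncate m lam) r g) := by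
    rw [ZMod.natCast_self, intertwiner_zero]
    rfl
  rw [h0, trace_eq_sum_cycles (len' := len) hn1 (fun i => by rw [ZMod.natCast_self, add_zero]) g
    hc (fun j => (one_mul _).symm) hpos]
  have hw : ∀ phi : Fin s → Fin n × Fin 1,
      ∏ x, ((g.left x : ℂˣ) : ℂ) ^ (cycleFill hn1 c phi x + (n : ZMod n)).val
        = ∏ j, ((xi j : ℂˣ) : ℂ) ^ ((phi j).1 : ℕ) := by
    intro phi
    rw [← c.prod_comp, Fintype.prod_sigma]
    refine Finset.prod_congr rfl fun j _ => ?_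
    have h1 : ((xi j : ℂˣ) : ℂ) = ∏ k, ((g.left (c ⟨j, k⟩) : ℂˣ) : ℂ) := by
      rw [← hg]
      simp
    rw [h1, ← Finset.prod_pow]
    refine Finset.prod_congr rfl fun k _ => ?_
    rw [cycleFill_apply, ZMod.natCast_self, mul_zero, sub_zero, add_zero,
      show phi j = ((phi j).1, (phi j).2) from rfl, residueEquiv_apply, rootsOfUnity_pow_val]
    simp
  simp only [hw]
  have htr : ∀ i : Fin n, truncate m lam ((i : ℕ) : ZMod n)
      = if (i : ℕ) < m then lam ((i : ℕ) : ZMod n) else ⊥ := by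
    intro i
    rw [truncate, ZMod.val_natCast_of_lt i.2]
  have hinj : Function.Injective fun (psi : Fin s → Fin m) (j : Fin s) =>
      (Fin.castLE hm (psi j), (0 : Fin 1)) := fun psi psi' hpp => funext fun j =>
    Fin.castLE_injective hm (congrArg Prod.fst (congrFun hpp j))
  refine (Fintype.sum_of_injective _ hinj _ _ ?_ ?_).symm
  · intro phi hphi
    have h1 : ∃ j, ¬ ((phi j).1 : ℕ) < m := by
      by_contra! h1
      exact hphi ⟨fun j => ⟨(phi j).1, h1 j⟩, funext fun j =>
        Prod.ext rfl (Subsingleton.elim _ _)⟩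
    obtain ⟨j, hj⟩ := h1
    -- A cycle placed in an empty component makes the corresponding character vanish.
    convert mul_zero _
    refine Finset.prod_eq_zero (Finset.mem_univ (phi j).1) ?_
    rw [htr, if_neg hj]
    have : Nonempty (Σ j' : {j' // ((phi j').1 : ℕ) = (phi j).1}, Fin (len j')) :=
      ⟨⟨⟨j, rfl⟩, ⟨0, hpos j⟩⟩⟩
    exact charOn_bot_of_nonempty _
  · intro psi
    congr 1
    refine Fintype.prod_of_injective (Fin.castLE hm) (Fin.castLE_injective hm) _ _ ?_ ?_
    · intro i hi
      have hi' : ¬ (i : ℕ) < m := fun h => hi ⟨⟨i, h⟩, rfl⟩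
      rw [htr, if_neg hi']
      have : IsEmpty (Σ j : {j // ((Fin.castLE hm (psi j) : Fin n) : ℕ) = i}, Fin (len j)) :=
        ⟨fun x => hi' (x.1.2 ▸ (psi x.1).2)⟩
      exact charOn_bot_of_isEmpty _
    · intro i
      rw [htr, if_pos (show ((Fin.castLE hm i : Fin n) : ℕ) < m from i.2)]
      rfl

end CycleSum

/-! ### Cycles and cyclic structures -/

section Cycles

theorem mem_cycles {r : ℕ} {σ : Perm (Fin r)} {S : Finset (Fin r)} :
    S ∈ cycles σ ↔ ∃ x, (Finset.univ.filter fun y => σ.SameCycle x y) = S := by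
  simp [cycles]

theorem pow_injOn_minimalPeriod {α : Type*} [Finite α] (σ : Perm α) (x : α) {a b : ℕ}
    (ha : a < Function.minimalPeriod σ x) (hb : b < Function.minimalPeriod σ x)
    (h : (σ ^ a) x = (σ ^ b) x) : a = b := by
  rw [← Equiv.Perm.iterate_eq_pow, ← Equiv.Perm.iterate_eq_pow] at h
  exact (Function.iterate_eq_iterate_iff_of_lt_minimalPeriod ha hb).1 h

theorem pow_mod_minimalPeriod {α : Type*} (σ : Perm α) (x : α) (k : ℕ) :
    (σ ^ (k % Function.minimalPeriod σ x)) x = (σ ^ k) x := by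
  rw [← Equiv.Perm.iterate_eq_pow, ← Equiv.Perm.iterate_eq_pow]
  exact Function.iterate_mod_minimalPeriod_eq

theorem minimalPeriod_pos_of_finite {α : Type*} [Finite α] (σ : Perm α) (x : α) :
    0 < Function.minimalPeriod σ x := by
  refine Function.IsPeriodicPt.minimalPeriod_pos (orderOf_pos σ) ?_
  rw [Function.IsPeriodicPt, Function.IsFixedPt, Equiv.Perm.iterate_eq_pow, pow_orderOf_eq_one,
    Equiv.Perm.one_apply]

theorem card_sameCycle {r : ℕ} (σ : Perm (Fin r)) (x : Fin r) :
    (Finset.univ.filter fun y => σ.SameCycle x y).card = Function.minimalPeriod σ x := by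
  rw [← Finset.card_range (Function.minimalPeriod σ x)]
  refine (Finset.card_bij (fun k _ => (σ ^ k) x) ?_ ?_ ?_).symm
  · intro k _
    exact Finset.mem_filter.2 ⟨Finset.mem_univ _, ⟨k, by simp⟩⟩
  · intro a ha b hb h
    exact pow_injOn_minimalPeriod σ x (Finset.mem_range.1 ha) (Finset.mem_range.1 hb) h
  · intro y hy
    obtain ⟨k, hk⟩ := ((Finset.mem_filter.1 hy).2).exists_nat_pow_eq
    exact ⟨k % Function.minimalPeriod σ x,
      Finset.mem_range.2 (Nat.mod_lt _ (minimalPeriod_pos_of_finite σ x)),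
      by rw [pow_mod_minimalPeriod, hk]⟩

/-- An enumeration of the cycles of `σ` yields cyclic coordinates on the letters. -/
theorem exists_cycle_coordinates {r s : ℕ} (σ : Perm (Fin r)) (β : Fin s ≃ {S // S ∈ cycles σ})
    (len : Fin s → ℕ) (hlen : ∀ j, (β j).1.card = len j) :
    ∃ c : (Σ j : Fin s, Fin (len j)) ≃ Fin r,
      (∀ j k, σ (c ⟨j, k⟩) = c ⟨j, finRotate (len j) k⟩) ∧
      ∀ j, (Finset.univ.image fun k => c ⟨j, k⟩) = (β j).1 := by
  choose x hx using fun j => mem_cycles.1 (β j).2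
  have hper : ∀ j, Function.minimalPeriod σ (x j) = len j := fun j => by
    rw [← card_sameCycle, hx, hlen]
  have hmem : ∀ j y, y ∈ (β j).1 ↔ σ.SameCycle (x j) y := fun j y => by
    rw [← hx]
    simp
  have hbij : Function.Bijective fun t : Σ j : Fin s, Fin (len j) => (σ ^ (t.2 : ℕ)) (x t.1) := by
    constructor
    · rintro ⟨j, k⟩ ⟨j', k'⟩ h
      simp only at h
      have hj : j = j' := by
        apply β.injective
        apply Subtype.ext
        have h1 : σ.SameCycle (x j) (x j') := by
          have h2 : σ.SameCycle (x j) ((σ ^ (k : ℕ)) (x j)) := ⟨k, by simp⟩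
          have h3 : σ.SameCycle (x j') ((σ ^ (k' : ℕ)) (x j')) := ⟨k', by simp⟩
          rw [h] at h2
          exact h2.trans h3.symm
        ext y
        rw [hmem, hmem]
        exact ⟨fun hy => h1.symm.trans hy, fun hy => h1.trans hy⟩
      subst hj
      have hk := pow_injOn_minimalPeriod σ (x j) (k.2.trans_eq (hper j).symm)
        (k'.2.trans_eq (hper j).symm) h
      rw [Fin.ext hk]
    · intro y
      obtain ⟨j, hj⟩ := β.surjective ⟨_, mem_cycles.2 ⟨y, rfl⟩⟩
      have h1 : σ.SameCycle (x j) y := by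
        rw [← hmem, hj]
        exact Finset.mem_filter.2 ⟨Finset.mem_univ _, Equiv.Perm.SameCycle.refl σ y⟩
      obtain ⟨k, hk⟩ := h1.exists_nat_pow_eq
      refine ⟨⟨j, ⟨k % len j, Nat.mod_lt _ ?_⟩⟩, ?_⟩
      · rw [← hper]
        exact minimalPeriod_pos_of_finite σ _
      · simp only [← hper, pow_mod_minimalPeriod, hk]
  refine ⟨Equiv.ofBijective _ hbij, fun j k => ?_, fun j => ?_⟩
  · simp only [Equiv.ofBijective_apply, finRotate_val]
    have h1 := pow_mod_minimalPeriod σ (x j) (k + 1)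
    rw [hper] at h1
    rw [h1, pow_succ', Equiv.Perm.mul_apply]
  · ext y
    rw [hmem]
    simp only [Finset.mem_image, Finset.mem_univ, true_and, Equiv.ofBijective_apply]
    constructor
    · rintro ⟨k, rfl⟩
      exact ⟨k, by simp⟩
    · intro h
      obtain ⟨k, hk⟩ := h.exists_nat_pow_eq
      refine ⟨⟨k % len j, Nat.mod_lt _ ?_⟩, ?_⟩
      · rw [← hper]
        exact minimalPeriod_pos_of_finite σ _
      · simp only [← hper, pow_mod_minimalPeriod, hk]

theorem mem_cycles_of_coordinates {r s : ℕ} {σ : Perm (Fin r)} {len : Fin s → ℕ}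
    {c : (Σ j : Fin s, Fin (len j)) ≃ Fin r} (hpos : ∀ j, 0 < len j)
    (hc : ∀ j k, σ (c ⟨j, k⟩) = c ⟨j, finRotate (len j) k⟩) (S : Finset (Fin r)) :
    S ∈ cycles σ ↔ ∃ j, (Finset.univ.image fun k => c ⟨j, k⟩) = S := by
  have h : ∀ j (k : Fin (len j)), (Finset.univ.filter fun y => σ.SameCycle (c ⟨j, k⟩) y)
      = Finset.univ.image fun k => c ⟨j, k⟩ := by
    intro j k
    ext y
    simp only [Finset.mem_filter, Finset.mem_univ, true_and, Finset.mem_image]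
    constructor
    · intro hy
      obtain ⟨t, rfl⟩ := hy.exists_nat_pow_eq
      exact ⟨_, (pow_apply_cycle hc t j k).symm⟩
    · rintro ⟨k', rfl⟩
      -- A natural exponent congruent to `k' - k` modulo the length.
      refine ⟨((k' + (len j - k) : ℕ) : ℤ), ?_⟩
      rw [zpow_natCast, pow_apply_cycle hc]
      congr 2
      apply Fin.ext
      have hk := k.2
      change (k + (k' + (len j - k)) : ℕ) % len j = k'
      rw [show (k + (k' + (len j - k)) : ℕ) = k' + len j by omega, Nat.add_mod_right,
        Nat.mod_eq_of_lt k'.2]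
  rw [mem_cycles]
  constructor
  · rintro ⟨x, rfl⟩
    obtain ⟨⟨j, k⟩, rfl⟩ := c.surjective x
    exact ⟨j, (h j k).symm⟩
  · rintro ⟨j, rfl⟩
    exact ⟨c ⟨j, ⟨0, hpos j⟩⟩, h j _⟩

variable {n : ℕ} [NeZero n] {r : ℕ} {eta : ZMod n → YoungDiagram}

theorem cycleProduct_image {s : ℕ} {len : Fin s → ℕ}
    (c : (Σ j : Fin s, Fin (len j)) ≃ Fin r) (g : G n r) (j : Fin s) :
    cycleProduct g (Finset.univ.image fun k => c ⟨j, k⟩) = ∏ k, g.left (c ⟨j, k⟩) := by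
  unfold cycleProduct
  refine Finset.prod_image fun k _ k' _ h => ?_
  have := c.injective h
  simpa using this

theorem PartListing.len_mem (L : PartListing r eta) (j : Fin L.s) :
    L.len j ∈ (eta (L.col j)).rowLens := by
  rw [← Multiset.mem_coe, ← L.parts, Multiset.mem_map]
  exact ⟨j, by simp, rfl⟩

theorem PartListing.len_pos (L : PartListing r eta) (j : Fin L.s) : 0 < L.len j :=
  (eta (L.col j)).pos_of_mem_rowLens _ (L.len_mem j)

theorem PartListing.exists_len_of_mem (L : PartListing r eta) {u : ZMod n} {x : ℕ}
    (hx : x ∈ (eta u).rowLens) : ∃ j, L.len j = x := by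
  rw [← Multiset.mem_coe, ← L.parts, Multiset.mem_map] at hx
  obtain ⟨j, -, hj⟩ := hx
  exact ⟨j, hj⟩

theorem PartListing.s_eq_numParts (L : PartListing r eta) : L.s = numParts eta := by
  have h : ∀ u, (eta u).rowLens.length = (Finset.univ.filter fun j => L.col j = u).card := by
    intro u
    have h1 := congrArg Multiset.card (L.parts u)
    rw [Multiset.card_map, Multiset.coe_card] at h1
    exact h1.symm
  rw [numParts, Finset.sum_congr rfl fun u _ => h u,
    ← Finset.card_eq_sum_card_fiberwise (f := L.col) (s := Finset.univ) (t := Finset.univ)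
      (fun _ _ => Finset.mem_coe.2 (Finset.mem_univ _)), Finset.card_univ, Fintype.card_fin]

theorem PartListing.rep_right_pos (ζ : rootsOfUnity n ℂ) (L : PartListing r eta) (j : Fin L.s)
    (k : Fin (L.len j)) :
    (L.rep ζ).right (L.pos ⟨j, k⟩) = L.pos ⟨j, finRotate (L.len j) k⟩ := by
  simp only [PartListing.rep, Equiv.permCongr_apply, Equiv.symm_apply_apply]
  rfl

theorem PartListing.rep_left_pos (ζ : rootsOfUnity n ℂ) (L : PartListing r eta) (j : Fin L.s)
    (k : Fin (L.len j)) :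
    (L.rep ζ).left (L.pos ⟨j, k⟩) = if (k : ℕ) = 0 then ζ ^ (L.col j).val else 1 := by
  simp only [PartListing.rep]
  rw [Equiv.symm_apply_apply]

theorem PartListing.cycleProduct_rep (ζ : rootsOfUnity n ℂ) (L : PartListing r eta)
    (j : Fin L.s) : cycleProduct (L.rep ζ) (Finset.univ.image fun k => L.pos ⟨j, k⟩)
      = ζ ^ (L.col j).val := by
  rw [cycleProduct_image, Finset.prod_eq_single ⟨0, L.len_pos j⟩]
  · rw [L.rep_left_pos, if_pos rfl]
  · intro k _ hk
    rw [L.rep_left_pos, if_neg fun hk' => hk (Fin.ext hk')]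
  · simp

/-- Converts conditions on the cycles of the representative into conditions on the listed parts. -/
theorem PartListing.forall_cycles (ζ : rootsOfUnity n ℂ) (L : PartListing r eta)
    (P : rootsOfUnity n ℂ → Prop) :
    (∀ S ∈ cycles (L.rep ζ).right, P (cycleProduct (L.rep ζ) S))
      ↔ ∀ j, P (ζ ^ (L.col j).val) := by
  constructor
  · intro h j
    rw [← L.cycleProduct_rep]
    exact h _ ((mem_cycles_of_coordinates L.len_pos (L.rep_right_pos ζ) _).2 ⟨j, rfl⟩)
  · intro h S hS
    obtain ⟨j, rfl⟩ := (mem_cycles_of_coordinates L.len_pos (L.rep_right_pos ζ) _).1 hS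
    rw [L.cycleProduct_rep]
    exact h j

theorem exists_isStar {q : ℕ} (hq : 0 < q) {mu : YoungDiagram}
    (h : ∀ x ∈ mu.rowLens, q ∣ x) : ∃ pi, IsStar q pi mu := by
  have hs : (mu.rowLens.map fun x => x / q).SortedGE :=
    (List.pairwise_map.2 (mu.rowLens_sorted.pairwise.imp fun hab => Nat.div_le_div_right hab)).sortedGE
  refine ⟨YoungDiagram.ofRowLens _ hs, ?_⟩
  rw [IsStar, YoungDiagram.rowLens_ofRowLens_eq_self, List.map_map]
  · exact ((List.map_congr_left fun x hx => Nat.mul_div_cancel' (h x hx)).trans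
      (List.map_id _)).symm
  · intro x hx
    obtain ⟨y, hy, rfl⟩ := List.mem_map.1 hx
    exact Nat.div_pos (Nat.le_of_dvd (mu.pos_of_mem_rowLens y hy) (h y hy)) hq

theorem exists_eq_pow_val {ζ : rootsOfUnity n ℂ} (hζ : IsPrimitiveRoot ζ n)
    (ξ : rootsOfUnity n ℂ) : ∃ u : ZMod n, ξ = ζ ^ u.val := by
  have h1 : IsPrimitiveRoot ((ζ : ℂˣ) : ℂ) n :=
    IsPrimitiveRoot.coe_units_iff.2 (IsPrimitiveRoot.coe_submonoidClass_iff.2 hζ)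
  have h2 : ((ξ : ℂˣ) : ℂ) ^ n = 1 := by
    rw [← Units.val_pow_eq_pow_val, (mem_rootsOfUnity _ _).1 ξ.2, Units.val_one]
  obtain ⟨i, hi, h3⟩ := h1.eq_pow_of_pow_eq_one h2
  refine ⟨i, ?_⟩
  rw [ZMod.val_natCast_of_lt hi]
  apply Subtype.ext
  apply Units.ext
  rw [← h3]
  simp

theorem pow_val_injective {ζ : rootsOfUnity n ℂ} (hζ : IsPrimitiveRoot ζ n) :
    Function.Injective fun u : ZMod n => ζ ^ u.val := fun u v h =>
  ZMod.val_injective n (hζ.pow_inj (ZMod.val_lt u) (ZMod.val_lt v) h)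

/-- The cycles of an element of cyclic structure `eta'` correspond to the parts of
`eta = q ⋆ eta'`. -/
theorem exists_cycles_equiv {ζ : rootsOfUnity n ℂ} (hζ : IsPrimitiveRoot ζ n)
    (L : PartListing r eta) {q r' : ℕ} (eta' : ZMod n → YoungDiagram)
    (hstar : ∀ u, IsStar q (eta' u) (eta u)) (g' : G n r')
    (hg' : HasCyclicStructure ζ g' eta') :
    ∃ β : Fin L.s ≃ {S // S ∈ cycles g'.right}, ∀ j,
      L.len j = q * (β j).1.card ∧ cycleProduct g' (β j).1 = ζ ^ (L.col j).val := by
  classical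
  let f : Fin L.s → rootsOfUnity n ℂ × ℕ := fun j => (ζ ^ (L.col j).val, L.len j)
  let f' : {S // S ∈ cycles g'.right} → rootsOfUnity n ℂ × ℕ :=
    fun S => (cycleProduct g' S.1, q * S.1.card)
  -- Both fibres are counted by the multiplicity of `l` among the parts of `eta u`, where the cycle
  -- product is `ζ ^ u`; fibrewise bijections then assemble to `β`.
  have hcard : ∀ x, Fintype.card {j // f j = x} = Fintype.card {S // f' S = x} := by
    rintro ⟨ξ, l⟩
    obtain ⟨u, rfl⟩ := exists_eq_pow_val hζ ξ
    have h1 : Fintype.card {j // f j = (ζ ^ u.val, l)}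
        = Multiset.count l ((eta u).rowLens : Multiset ℕ) := by
      rw [← L.parts, Multiset.count_map, Fintype.card_subtype, ← Finset.filter_val,
        Finset.card_val, Finset.filter_filter]
      congr 1
      ext j
      simp only [f, Prod.mk.injEq, (pow_val_injective hζ).eq_iff, Finset.mem_filter,
        Finset.mem_univ, true_and, eq_comm (a := l)]
    have h2 : Fintype.card {S // f' S = (ζ ^ u.val, l)}
        = Multiset.count l ((eta u).rowLens : Multiset ℕ) := by
      rw [hstar u, ← Multiset.map_coe, ← hg' u, Multiset.map_map, Multiset.count_map,
        Fintype.card_subtype, ← Finset.filter_val, Finset.card_val, Finset.filter_filter]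
      refine Finset.card_bij (fun S _ => S.1) ?_ ?_ ?_
      · intro S hS
        simp only [f', Finset.mem_filter, Finset.mem_univ, true_and, Prod.mk.injEq] at hS
        exact Finset.mem_filter.2 ⟨S.2, hS.1, hS.2.symm⟩
      · intro _ _ _ _ h
        exact Subtype.ext h
      · intro S hS
        rw [Finset.mem_filter] at hS
        exact ⟨⟨S, hS.1⟩, Finset.mem_filter.2 ⟨Finset.mem_univ _,
          Prod.ext hS.2.1 hS.2.2.symm⟩, rfl⟩
    rw [h1, h2]
  refine ⟨Equiv.ofFiberEquiv fun x => Fintype.equivOfCardEq (hcard x), fun j => ?_⟩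
  have h := Equiv.ofFiberEquiv_map (fun x => Fintype.equivOfCardEq (hcard x)) j
  exact ⟨(congrArg Prod.snd h).symm, congrArg Prod.fst h⟩

end Cycles

/-! ### The traces `Δ` -/

section Delta

variable {d e r : ℕ} [NeZero (d * e)] {lam eta : ZMod (d * e) → YoungDiagram}

theorem Delta_eq_trace {b : ℕ} (h : ∀ i, lam (i + ((d * b : ℕ) : ZMod (d * e))) = lam i) (k : ℕ)
    (g : G (d * e) r) : Delta lam r b k g = LinearMap.trace ℂ (W lam r)
      (intertwiner lam r ((d * b * k : ℕ) : ZMod (d * e)) ∘ₗ rho lam r g) := by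
  rw [Delta, intertwiner_pow _ h]
  congr 3
  push_cast
  ring

theorem lam_add_period {b : ℕ} (h : ∀ i, lam (i + ((d * b : ℕ) : ZMod (d * e))) = lam i) (k : ℕ)
    (i : ZMod (d * e)) : lam (i + ((d * b * k : ℕ) : ZMod (d * e))) = lam i := by
  rw [← lam_add_natCast_mul h k i]
  push_cast
  congr 1
  ring

theorem Delta_rep_eq_zero_of_not_dvd {b k q : ℕ} [NeZero q]
    (h : ∀ i, lam (i + ((d * b : ℕ) : ZMod (d * e))) = lam i) (hn : d * e = q * (d * b * k))
    (ζ : rootsOfUnity (d * e) ℂ) (L : PartListing r eta) {j : Fin L.s} (hj : ¬ q ∣ L.len j) :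
    Delta lam r b k (L.rep ζ) = 0 := by
  rw [Delta_eq_trace h, trace_intertwiner_comp_rho q _ hn (lam_add_period h k)]
  refine Finset.sum_eq_zero fun X _ => if_neg fun hX => hj ?_
  exact dvd_len_of_shift hn hX (L.rep_right_pos ζ) (L.len_pos j)

theorem Delta_rep_of_dvd {b k q : ℕ} [NeZero q]
    (h : ∀ i, lam (i + ((d * b : ℕ) : ZMod (d * e))) = lam i) (hn : d * e = q * (d * b * k))
    (ζ : rootsOfUnity (d * e) ℂ) (L : PartListing r eta) (len' : Fin L.s → ℕ)
    (hlen : ∀ j, L.len j = q * len' j) :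
    Delta lam r b k (L.rep ζ)
      = (∏ j, ∑ i : Fin q, ((((ζ ^ (L.col j).val : rootsOfUnity (d * e) ℂ) : ℂˣ) : ℂ)
          ^ (d * b * k)) ^ ((i : ℕ) + 1)) *
        cycleSum lam (d * b * k) len' fun j => ζ ^ (L.col j).val := by
  rw [Delta_eq_trace h]
  exact trace_eq_mul_cycleSum hn (lam_add_period h k) _ (L.rep_right_pos ζ) hlen L.len_pos _
    (L.rep_left_pos ζ)

end Delta

theorem sum_pow_succ_eq_zero {q : ℕ} {y : ℂ} (hq : y ^ q = 1) (hy : y ≠ 1) :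
    ∑ i : Fin q, y ^ ((i : ℕ) + 1) = 0 := by
  rw [Fin.sum_univ_eq_sum_range fun i => y ^ (i + 1)]
  simp only [pow_succ]
  rw [← Finset.sum_mul, geom_sum_eq hy, hq, sub_self, zero_div, zero_mul]

end WreathChar

end

theorem theorem3 (d e r : ℕ) [NeZero d] [NeZero e] (hr : 0 < r)
    (ζ : rootsOfUnity (d * e) ℂ) (hζ : IsPrimitiveRoot ζ (d * e))
    (lam : ZMod (d * e) → YoungDiagram) (hlam : WreathChar.IsMultipartition r lam)
    (b : ℕ) (hb : b ∣ e)
    (hC : WreathChar.C lam r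
      = (Subgroup.zpowers (WreathChar.eps d e r ^ b) : Set (WreathChar.G (d * e) r →* ℂˣ)))
    (b' q r' : ℕ) (hq : (WreathChar.C lam r).ncard = q * b') (hr' : r = q * r')
    (eta : ZMod (d * e) → YoungDiagram) (heta : WreathChar.IsMultipartition r eta)
    (L : WreathChar.PartListing r eta) :
    (((∃ u, ¬ ∃ pi, WreathChar.IsStar q pi (eta u)) ∨
        (∃ c ∈ WreathChar.cycles (L.rep ζ).right,
          WreathChar.cycleProduct (L.rep ζ) c ^ (d * b * b') ≠ 1)) →
      WreathChar.Delta lam r b b' (L.rep ζ) = 0) ∧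
    (∀ eta' : ZMod (d * e) → YoungDiagram, (∀ u, WreathChar.IsStar q (eta' u) (eta u)) →
      (∀ c ∈ WreathChar.cycles (L.rep ζ).right,
        WreathChar.cycleProduct (L.rep ζ) c ^ (d * b * b') = 1) →
      ∀ g' : WreathChar.G (d * e) r', WreathChar.HasCyclicStructure ζ g' eta' →
        WreathChar.Delta lam r b b' (L.rep ζ)
          = (q : ℂ) ^ WreathChar.numParts eta
            * WreathChar.chi (WreathChar.truncate (d * b * b') lam) r' g') := by
  have hd : 0 < d := Nat.pos_of_ne_zero (NeZero.ne d)
  have he : 0 < e := Nat.pos_of_ne_zero (NeZero.ne e)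
  have heq : e = b * (q * b') :=
    WreathChar.eq_mul_of_ncard hd he hr hζ hb (by rw [← hC, hq])
  have hn : d * e = q * (d * b * b') := by
    rw [heq]
    ring
  have hq0 : 0 < q := Nat.pos_of_ne_zero fun h => by
    rw [h, zero_mul, mul_zero] at heq
    exact he.ne' heq
  have hqne : NeZero q := ⟨hq0.ne'⟩
  have hinv : ∀ i, lam (i + ((d * b : ℕ) : ZMod (d * e))) = lam i :=
    WreathChar.shift_invariant_of_mem_C hζ hlam
      (by rw [hC]; exact Subgroup.mem_zpowers _)
  have hunit : ∀ (ξ : rootsOfUnity (d * e) ℂ), (((ξ : ℂˣ) : ℂ) ^ (d * b * b') = 1)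
      ↔ ξ ^ (d * b * b') = 1 := by
    intro ξ
    rw [← Units.val_pow_eq_pow_val, Units.val_eq_one, ← Subgroup.coe_pow, OneMemClass.coe_eq_one]
  constructor
  · intro hcases
    -- If `q` divides all lengths, every `eta u` is of the form `q ⋆ pi`, and only the condition on
    -- cycle products can fail.
    by_cases hdiv : ∀ j, q ∣ L.len j
    · choose len' hlen using hdiv
      rw [WreathChar.Delta_rep_of_dvd hinv hn ζ L len' hlen]
      rcases hcases with ⟨u, hu⟩ | hprod
      · refine absurd (WreathChar.exists_isStar hq0 fun x hx => ?_) hu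
        obtain ⟨j, rfl⟩ := L.exists_len_of_mem hx
        exact ⟨_, hlen j⟩
      · have hprod' : ¬ ∀ j, (ζ ^ (L.col j).val) ^ (d * b * b') = 1 := by
          rw [← L.forall_cycles ζ fun ξ => ξ ^ (d * b * b') = 1]
          push Not
          exact hprod
        push Not at hprod'
        obtain ⟨j, hj⟩ := hprod'
        rw [Finset.prod_eq_zero (Finset.mem_univ j), zero_mul]
        refine WreathChar.sum_pow_succ_eq_zero ?_ fun h1 => hj ((hunit _).1 h1)
        -- `ξ ^ m` is a `q`-th root of unity because `q m = d e`; as it is not `1`, the geometric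
        -- sum vanishes.
        rw [← pow_mul, mul_comm _ q, ← hn, ← Units.val_pow_eq_pow_val,
          (mem_rootsOfUnity _ _).1 (ζ ^ (L.col j).val).2, Units.val_one]
    · push Not at hdiv
      obtain ⟨j, hj⟩ := hdiv
      exact WreathChar.Delta_rep_eq_zero_of_not_dvd hinv hn ζ L hj
  · intro eta' hstar hprod g' hg'
    obtain ⟨β, hβ⟩ := WreathChar.exists_cycles_equiv hζ L eta' hstar g' hg'
    have hlen : ∀ j, L.len j = q * (β j).1.card := fun j => (hβ j).1
    have hpos : ∀ j, 0 < (β j).1.card := fun j =>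
      Nat.pos_of_ne_zero fun h => (L.len_pos j).ne' (by rw [hlen, h, mul_zero])
    -- The cycles of `g'` are numbered like the parts of `eta`, so that both traces involve the same
    -- `cycleSum`.
    obtain ⟨c, hc, himg⟩ := WreathChar.exists_cycle_coordinates g'.right β
      (fun j => (β j).1.card) fun _ => rfl
    have hm : d * b * b' ≤ d * e := by
      rw [hn]
      exact Nat.le_mul_of_pos_left _ hq0
    rw [WreathChar.Delta_rep_of_dvd hinv hn ζ L _ hlen,
      WreathChar.chi_truncate_eq_cycleSum hm g' hc hpos (fun j => ζ ^ (L.col j).val) fun j =>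
        (WreathChar.cycleProduct_image c g' j).symm.trans (by rw [himg, (hβ j).2])]
    congr 1
    have hone := (L.forall_cycles ζ fun ξ => ξ ^ (d * b * b') = 1).1 hprod
    rw [← L.s_eq_numParts]
    have hterm : ∀ j, ∑ i : Fin q, ((((ζ ^ (L.col j).val : rootsOfUnity (d * e) ℂ) : ℂˣ) : ℂ)
        ^ (d * b * b')) ^ ((i : ℕ) + 1) = q := by
      intro j
      rw [(hunit _).2 (hone j)]
      simp
    rw [Finset.prod_congr rfl fun j _ => hterm j]
    simp
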